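/- **Notation.** Let $K$ be a field of characteristic zero (for instance $K=\mathbb{Q}$) and $n\ge 0$. Let ${\sf ass}_n$ be the free associative $K$-algebra on $x_1,\dots,x_n$, with coproduct $\Delta(x_i)=x_i\otimes 1+1\otimes x_i$ and antipode $\iota$ (the anti-automorphism with $\iota(x_i)=-x_i$). Let ${\sf lie}_n$ be the free Lie algebra on $x_1,\dots,x_n$, regarded inside ${\sf ass}_n$. Put ${\sf tr}_n={\sf ass}_n/[{\sf ass}_n,{\sf ass}_n]$, where $[{\sf ass}_n,{\sf ass}_n]$ is the span of the commutators, with projection $|\ |:{\sf ass}_n\to{\sf tr}_n$, and $x_0=x_1+\cdots+x_n$. *Tangential derivations.* An element $\tilde u=(u_1,\dots,u_n)$ of ${\sf tder}_n={\sf lie}_n^{\oplus n}$ acts on ${\sf ass}_n$ by the derivation $\rho(\tilde u)$ with $\rho(\tilde u)(x_i)=[x_i,u_i]$, hence on ${\sf tr}_n$, and on tensor products by $\rho(\tilde u)\otimes{\rm id}+{\rm id}\otimes\rho(\tilde u)$. Let ${\sf sder}_n=\{\tilde u\in{\sf tder}_n : \rho(\tilde u)(x_0)=0\}$. Let $\partial_i$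 be the linear operators with $\partial_i(1)=0$ and $\partial_i(a x_j)=\delta_{ij}a$ for $a\in{\sf ass}_n$, and put ${\rm div}(\tilde u)=\sum_{i=1}^n|x_i(\partial_iu_i)|\in{\sf tr}_n$. Then - ${\sf krv}_n$ is the set of $\tilde u\in{\sf sder}_n$ such that ${\rm div}(\tilde u)=\sum_{i=0}^n|f_i(x_i)|$, in the degree completion of ${\sf tr}_n$, for some formal power series $f_0,\dots,f_n\in K[[s]]$; - ${\sf krv}_n^0$ is the set of $\tilde u\in{\sf sder}_n$ such that ${\rm div}(\tilde u)$ lies in the span of $|x_1|,\dots,|x_n|$. *Operations.* Let $\mathfrak z(x_i,x_j)=\delta_{ij}x_i$. The linearized homotopy intersection form $\eta_{\rm gr}:{\sf ass}_n\otimes{\sf ass}_n\to{\sf ass}_n$ is the linear map with $\eta_{\rm gr}(1,v)=\eta_{\rm gr}(u,1)=0$ and, for letters $a_i,b_j\in\{x_1,\dots,x_n\}$ and $l,m\ge1$, $$\eta_{\rm gr}(a_1\cdots a_l,\,b_1\cdots b_m)=-a_1\cdots a_{l-1}\,\mathfrak z(a_l,b_1)\,b_2\cdots b_m .$$ The linear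 map $\mu^f_{\rm gr}:{\sf ass}_n\to{\sf ass}_n$ is given by $$\mu^f_{\rm gr}(a_1\cdots a_m)=-\sum_{j=1}^{m-1}a_1\cdots a_{j-1}\,\mathfrak z(a_j,a_{j+1})\,a_{j+2}\cdots a_m .$$ Let $\mu^f_{r,\rm gr}:{\sf ass}_n\to{\sf tr}_n\otimes{\sf ass}_n$ be the composition of $\Delta$, ${\rm id}\otimes\mu^f_{\rm gr}$, ${\rm id}\otimes((\iota\otimes{\rm id})\circ\Delta)$ and $(|\ |\circ{\rm mult})\otimes{\rm id}$. The linearized framed Turaev cobracket $\delta^f_{\rm gr}:{\sf tr}_n\to{\sf tr}_n\otimes{\sf tr}_n$ is the (well-defined) linear map with $$\delta^f_{\rm gr}(|a|)={\rm Alt}\circ({\rm id}\otimes|\ |)\circ\mu^f_{r,\rm gr}(a),\qquad {\rm Alt}(p\otimes q)=p\otimes q-q\otimes p .$$ **Theorem.** Let $\tilde u=(u_1,\dots,u_n)\in{\sf tder}_n$. (i) $\tilde u\in{\sf krv}_n$ if and only if $\rho(\tilde u)$ commutes with $\eta_{\rm gr}$ and with $\delta^f_{\rm gr}$, that is, $\rho(\tilde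 u)\circ\eta_{\rm gr}=\eta_{\rm gr}\circ(\rho(\tilde u)\otimes{\rm id}+{\rm id}\otimes\rho(\tilde u))$ and $(\rho(\tilde u)\otimes{\rm id}+{\rm id}\otimes\rho(\tilde u))\circ\delta^f_{\rm gr}=\delta^f_{\rm gr}\circ\rho(\tilde u)$. (ii) $\tilde u\in{\sf krv}_n^0$ if and only if $\rho(\tilde u)$ commutes with $\eta_{\rm gr}$ and with $\mu^f_{\rm gr}$, the latter meaning $\rho(\tilde u)\circ\mu^f_{\rm gr}=\mu^f_{\rm gr}\circ\rho(\tilde u)$. -/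

import Mathlib

open scoped TensorProduct

noncomputable section

namespace KV

variable (K : Type*) [Field K] (n : ℕ)

attribute [local instance 100] LieRing.ofAssociativeRing

/-! ### The free associative algebra `ass_n` and its trace space `tr_n` -/

/-- `ass_n`: the free associative algebra on `x_1, …, x_n`. -/
abbrev Ass : Type _ := FreeAlgebra K (Fin n)

/-- The generators `x_1, …, x_n` (indexed from `0`). -/
abbrev gen (i : Fin n) : Ass K n := FreeAlgebra.ι K i

/-- The element `x_0 = x_1 + ⋯ + x_n`. -/
def gen₀ : Ass K n := ∑ i, gen K n i

/-- The word `x_{i_1} ⋯ x_{i_m}` of `ass_n`. -/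
def word (l : List (Fin n)) : Ass K n := (l.map (gen K n)).prod

/-- The words form a basis of `ass_n`. -/
abbrev wordBasis : Module.Basis (FreeMonoid (Fin n)) K (Ass K n) :=
  FreeAlgebra.basisFreeMonoid K (Fin n)

/-- The linear map out of `ass_n` with prescribed values on words. -/
def onWords {M : Type*} [AddCommGroup M] [Module K M] (f : List (Fin n) → M) :
    Ass K n →ₗ[K] M :=
  (wordBasis K n).constr K fun w => f (FreeMonoid.toList w)

/-- The subspace `[ass_n, ass_n]` spanned by the commutators. -/
def commutators : Submodule K (Ass K n) :=
  Submodule.span K {c | ∃ a b : Ass K n, c = a * b - b * a}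

/-- `tr_n = |ass_n| = ass_n / [ass_n, ass_n]`. -/
abbrev Tr : Type _ := Ass K n ⧸ commutators K n

/-- The projection `| | : ass_n → tr_n`. -/
def tr : Ass K n →ₗ[K] Tr K n := (commutators K n).mkQ

/-! ### Hopf algebra structure of `ass_n` -/

/-- The coproduct: the algebra map with `Δ(x_i) = x_i ⊗ 1 + 1 ⊗ x_i`. -/
def coproduct : Ass K n →ₐ[K] Ass K n ⊗[K] Ass K n :=
  FreeAlgebra.lift K fun i => gen K n i ⊗ₜ[K] 1 + 1 ⊗ₜ[K] gen K n i

/-- The antipode: the linear anti-automorphism with `ι(x_i) = - x_i`. -/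
def antipode : Ass K n →ₗ[K] Ass K n :=
  (MulOpposite.opLinearEquiv K).symm.toLinearMap ∘ₗ
    (FreeAlgebra.lift K fun i => MulOpposite.op (-gen K n i) :
      Ass K n →ₐ[K] (Ass K n)ᵐᵒᵖ).toLinearMap

/-! ### The linearized loop operations -/

/-- The bilinear map `𝔷` on letters: `𝔷(x_i, x_j) = δ_{ij} x_i`. -/
def zz (i j : Fin n) : Ass K n := if i = j then gen K n i else 0

/-- Given `a_1 ⋯ a_l` (as `u`) and `b_1 ⋯ b_m` (as `v`), the element
`- a_1 ⋯ a_{l-1} 𝔷(a_l, b_1) b_2 ⋯ b_m`; it is `0` if one of the words is empty. -/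
def etaWord (u v : List (Fin n)) : Ass K n :=
  match u.getLast?, v with
  | some i, j :: v' => -(word K n u.dropLast * zz K n i j * word K n v')
  | _, _ => 0

/-- The linearized homotopy intersection form, as a bilinear map. -/
def etaBil : Ass K n →ₗ[K] Ass K n →ₗ[K] Ass K n :=
  onWords K n fun u => onWords K n fun v => etaWord K n u v

/-- The linearized homotopy intersection form `η_gr : ass_n ⊗ ass_n → ass_n`. -/
def etaGr : Ass K n ⊗[K] Ass K n →ₗ[K] Ass K n := TensorProduct.lift (etaBil K n)

/-- For the word `a_1 ⋯ a_m`, the element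
`- ∑_{j=1}^{m-1} a_1 ⋯ a_{j-1} 𝔷(a_j, a_{j+1}) a_{j+2} ⋯ a_m`
(the first summand is split off, and `a_1` is factored out of the others). -/
def muWord : List (Fin n) → Ass K n
  | [] => 0
  | [_] => 0
  | i :: j :: l => -(zz K n i j * word K n l) + gen K n i * muWord (j :: l)

/-- The map `μ^f_gr : ass_n → ass_n`. -/
def muGr : Ass K n →ₗ[K] Ass K n := onWords K n (muWord K n)

/-- The map `a ⊗ b ↦ ∑ |a ι(b')| ⊗ b''`, where `Δ(b) = ∑ b' ⊗ b''`: the composition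
`((| | ∘ mult) ⊗ id) ∘ (id ⊗ ((ι ⊗ id) ∘ Δ))`. -/
def closeUp : Ass K n ⊗[K] Ass K n →ₗ[K] Tr K n ⊗[K] Ass K n :=
  LinearMap.rTensor (Ass K n) (tr K n ∘ₗ LinearMap.mul' K (Ass K n)) ∘ₗ
    (TensorProduct.assoc K (Ass K n) (Ass K n) (Ass K n)).symm.toLinearMap ∘ₗ
      LinearMap.lTensor (Ass K n)
        (LinearMap.rTensor (Ass K n) (antipode K n) ∘ₗ (coproduct K n).toLinearMap)

/-- The map `μ^f_{r,gr} : ass_n → tr_n ⊗ ass_n`, namely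
`((| | ∘ mult) ⊗ id) ∘ (id ⊗ ((ι ⊗ id) ∘ Δ)) ∘ (id ⊗ μ^f_gr) ∘ Δ`. -/
def murGr : Ass K n →ₗ[K] Tr K n ⊗[K] Ass K n :=
  closeUp K n ∘ₗ LinearMap.lTensor (Ass K n) (muGr K n) ∘ₗ (coproduct K n).toLinearMap

/-- `Alt(a ⊗ b) = a ⊗ b - b ⊗ a`. -/
def alt (V : Type*) [AddCommGroup V] [Module K V] : V ⊗[K] V →ₗ[K] V ⊗[K] V :=
  LinearMap.id - (TensorProduct.comm K V V).toLinearMap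

/-- The map `Alt ∘ (id ⊗ | |) ∘ μ^f_{r,gr} : ass_n → tr_n ⊗ tr_n`. -/
def deltaLift : Ass K n →ₗ[K] Tr K n ⊗[K] Tr K n :=
  alt K (Tr K n) ∘ₗ LinearMap.lTensor (Tr K n) (tr K n) ∘ₗ murGr K n

/-! #### `deltaLift` vanishes on commutators, hence descends to `tr_n` -/

section descent

theorem word_nil : word K n [] = 1 := rfl

theorem word_cons (i : Fin n) (l : List (Fin n)) :
    word K n (i :: l) = gen K n i * word K n l := by simp [word]

theorem word_append (l m : List (Fin n)) : word K n (l ++ m) = word K n l * word K n m := by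
  simp [word]

theorem word_single (i : Fin n) : word K n [i] = gen K n i := by simp [word]

theorem wordBasis_apply (w : FreeMonoid (Fin n)) :
    wordBasis K n w = word K n (FreeMonoid.toList w) := by
  simp [wordBasis, FreeAlgebra.basisFreeMonoid, FreeAlgebra.equivMonoidAlgebraFreeMonoid, word,
    FreeMonoid.lift_apply]

theorem onWords_word {M : Type*} [AddCommGroup M] [Module K M] (f : List (Fin n) → M)
    (l : List (Fin n)) : onWords K n f (word K n l) = f l := by
  have h := wordBasis_apply K n (FreeMonoid.ofList l)
  rw [FreeMonoid.toList_ofList] at h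
  rw [← h, onWords, Module.Basis.constr_basis, FreeMonoid.toList_ofList]

/-- Linear maps out of `ass_n` that agree on words are equal. -/
theorem ext_words {M : Type*} [AddCommGroup M] [Module K M] {f g : Ass K n →ₗ[K] M}
    (h : ∀ l, f (word K n l) = g (word K n l)) : f = g :=
  (wordBasis K n).ext fun w => by rw [wordBasis_apply]; exact h _

theorem tr_mul_comm (a b : Ass K n) : tr K n (a * b) = tr K n (b * a) := by
  rw [← sub_eq_zero, ← map_sub]
  exact (Submodule.Quotient.mk_eq_zero _).2 (Submodule.subset_span ⟨a, b, rfl⟩)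

theorem coproduct_gen (i : Fin n) :
    coproduct K n (gen K n i) = gen K n i ⊗ₜ[K] 1 + 1 ⊗ₜ[K] gen K n i := by
  simp [coproduct]

theorem antipode_gen (i : Fin n) : antipode K n (gen K n i) = -gen K n i := by
  simp [antipode]

theorem antipode_one : antipode K n 1 = 1 := by simp [antipode]

theorem antipode_mul (a b : Ass K n) :
    antipode K n (a * b) = antipode K n b * antipode K n a := by
  simp [antipode]

theorem etaBil_gen_word (i : Fin n) (l : List (Fin n)) :
    etaBil K n (gen K n i) (word K n l) = etaWord K n [i] l := by
  rw [← word_single, etaBil, onWords_word, onWords_word]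

theorem etaBil_gen_mul (i j : Fin n) (a : Ass K n) :
    etaBil K n (gen K n i) (gen K n j * a) = if j = i then -(gen K n i * a) else 0 := by
  have : etaBil K n (gen K n i) ∘ₗ LinearMap.mulLeft K (gen K n j) =
      if j = i then -LinearMap.mulLeft K (gen K n i) else 0 := by
    refine ext_words K n fun l => ?_
    rw [LinearMap.comp_apply, LinearMap.mulLeft_apply, ← word_cons, etaBil_gen_word]
    by_cases h : j = i
    · simp [etaWord, zz, h, word_nil]
    · simp [etaWord, zz, h, Ne.symm h]
  have h := LinearMap.congr_fun this a
  rw [LinearMap.comp_apply, LinearMap.mulLeft_apply] at h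
  rw [h]
  split_ifs <;> simp

theorem etaBil_mul_gen (i j : Fin n) (a : Ass K n) :
    etaBil K n (a * gen K n j) (gen K n i) = if j = i then -(a * gen K n i) else 0 := by
  have : (etaBil K n).flip (gen K n i) ∘ₗ LinearMap.mulRight K (gen K n j) =
      if j = i then -LinearMap.mulRight K (gen K n i) else 0 := by
    refine ext_words K n fun l => ?_
    rw [LinearMap.comp_apply, LinearMap.mulRight_apply, ← word_single K n j, ← word_append,
      LinearMap.flip_apply]
    conv_lhs => rw [← word_single K n i, etaBil, onWords_word, onWords_word]
    by_cases h : j = i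
    · simp [etaWord, zz, h, word_nil]
    · simp [etaWord, zz, h]
  have h := LinearMap.congr_fun this a
  rw [LinearMap.comp_apply, LinearMap.mulRight_apply] at h
  rw [← LinearMap.flip_apply, h]
  split_ifs <;> simp

theorem muGr_gen_mul (i : Fin n) (a : Ass K n) :
    muGr K n (gen K n i * a) = gen K n i * muGr K n a + etaBil K n (gen K n i) a := by
  have : muGr K n ∘ₗ LinearMap.mulLeft K (gen K n i) =
      LinearMap.mulLeft K (gen K n i) ∘ₗ muGr K n + etaBil K n (gen K n i) := by
    refine ext_words K n fun l => ?_
    simp only [LinearMap.comp_apply, LinearMap.mulLeft_apply, LinearMap.add_apply]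
    rw [← word_cons, etaBil_gen_word, muGr, onWords_word, onWords_word]
    cases l with
    | nil => simp [muWord, etaWord]
    | cons j l => simp [muWord, etaWord, word_nil, add_comm]
  exact LinearMap.congr_fun this a

theorem muWord_append_single (i : Fin n) (l : List (Fin n)) :
    muWord K n (l ++ [i]) = muWord K n l * gen K n i + etaWord K n l [i] := by
  induction l with
  | nil => simp [muWord, etaWord]
  | cons j l ih =>
    cases l with
    | nil => simp [muWord, etaWord, word_nil]
    | cons k l =>
      have e : etaWord K n (j :: k :: l) [i] = gen K n j * etaWord K n (k :: l) [i] := by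
        simp only [etaWord, List.getLast?_cons_cons]
        have : (k :: l).getLast? = some ((k :: l).getLast (by simp)) :=
          List.getLast?_eq_some_getLast (by simp)
        rw [this]
        simp [word_cons, mul_assoc]
      simp only [List.cons_append, muWord] at ih ⊢
      rw [ih, e, word_append, word_single]
      noncomm_ring

theorem muGr_mul_gen (i : Fin n) (a : Ass K n) :
    muGr K n (a * gen K n i) = muGr K n a * gen K n i + etaBil K n a (gen K n i) := by
  have : muGr K n ∘ₗ LinearMap.mulRight K (gen K n i) =
      LinearMap.mulRight K (gen K n i) ∘ₗ muGr K n + (etaBil K n).flip (gen K n i) := by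
    refine ext_words K n fun l => ?_
    simp only [LinearMap.comp_apply, LinearMap.mulRight_apply, LinearMap.add_apply,
      LinearMap.flip_apply]
    rw [← word_single, ← word_append, muGr, etaBil]
    simp only [onWords_word]
    rw [muWord_append_single, word_single]
  exact LinearMap.congr_fun this a

/-- Left multiplication by `x_i` on the second factor of `tr_n ⊗ ass_n`. -/
def lmul (i : Fin n) : Tr K n ⊗[K] Ass K n →ₗ[K] Tr K n ⊗[K] Ass K n :=
  LinearMap.lTensor (Tr K n) (LinearMap.mulLeft K (gen K n i))

/-- Right multiplication by `x_i` on the second factor of `tr_n ⊗ ass_n`. -/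
def rmul (i : Fin n) : Tr K n ⊗[K] Ass K n →ₗ[K] Tr K n ⊗[K] Ass K n :=
  LinearMap.lTensor (Tr K n) (LinearMap.mulRight K (gen K n i))

/-- The map `p ⊗ q ↦ |a ι(p)| ⊗ q`. -/
def closeAux (a : Ass K n) : Ass K n ⊗[K] Ass K n →ₗ[K] Tr K n ⊗[K] Ass K n :=
  LinearMap.rTensor (Ass K n) (tr K n ∘ₗ LinearMap.mulLeft K a ∘ₗ antipode K n)

theorem closeUp_tmul (a b : Ass K n) :
    closeUp K n (a ⊗ₜ b) = closeAux K n a (coproduct K n b) := by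
  simp only [closeUp, closeAux, LinearMap.comp_apply, LinearMap.lTensor_tmul,
    AlgHom.toLinearMap_apply]
  induction coproduct K n b with
  | zero => simp
  | tmul p q => simp
  | add s t hs ht => rw [map_add, TensorProduct.tmul_add, map_add, map_add, map_add, hs, ht]

theorem closeUp_left (i : Fin n) (t : Ass K n ⊗[K] Ass K n) :
    closeUp K n ((1 ⊗ₜ gen K n i) * t) =
      -closeUp K n ((gen K n i ⊗ₜ 1) * t) + lmul K n i (closeUp K n t) := by
  induction t with
  | zero => simp
  | add s t hs ht => simp only [mul_add, map_add, hs, ht]; abel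
  | tmul a b =>
    simp only [Algebra.TensorProduct.tmul_mul_tmul, one_mul, closeUp_tmul, map_mul,
      coproduct_gen]
    induction coproduct K n b with
    | zero => simp
    | add s t hs ht => simp only [mul_add, map_add, hs, ht]; abel
    | tmul p q =>
      have e : tr K n (a * (antipode K n p * gen K n i)) =
          tr K n (gen K n i * (a * antipode K n p)) := by rw [← mul_assoc, tr_mul_comm]
      simp [closeAux, lmul, add_mul, antipode_mul, antipode_gen, TensorProduct.neg_tmul, e]

theorem closeUp_right (i : Fin n) (t : Ass K n ⊗[K] Ass K n) :
    closeUp K n (t * (1 ⊗ₜ gen K n i)) =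
      -closeUp K n (t * (gen K n i ⊗ₜ 1)) + rmul K n i (closeUp K n t) := by
  induction t with
  | zero => simp
  | add s t hs ht => simp only [add_mul, map_add, hs, ht]; abel
  | tmul a b =>
    simp only [Algebra.TensorProduct.tmul_mul_tmul, mul_one, closeUp_tmul, map_mul,
      coproduct_gen]
    induction coproduct K n b with
    | zero => simp
    | add s t hs ht => simp only [add_mul, map_add, hs, ht]; abel
    | tmul p q =>
      simp [closeAux, rmul, mul_add, antipode_mul, antipode_gen, TensorProduct.neg_tmul]

theorem closeUp_coproduct_left (l : List (Fin n)) : ∀ a : Ass K n,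
    closeUp K n ((a ⊗ₜ 1) * coproduct K n (word K n l)) = tr K n a ⊗ₜ word K n l := by
  induction l with
  | nil => intro a; simp [word_nil, closeUp_tmul, closeAux, antipode_one,
      Algebra.TensorProduct.one_def]
  | cons j l ih =>
    intro a
    have h1 : (a ⊗ₜ[K] (1 : Ass K n)) * coproduct K n (word K n (j :: l)) =
        ((a * gen K n j) ⊗ₜ[K] 1) * coproduct K n (word K n l) +
        (1 ⊗ₜ[K] gen K n j) * ((a ⊗ₜ[K] 1) * coproduct K n (word K n l)) := by
      rw [word_cons, map_mul, coproduct_gen, ← mul_assoc, ← mul_assoc, mul_add, add_mul]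
      simp
    have h2 : (gen K n j ⊗ₜ[K] (1 : Ass K n)) * ((a ⊗ₜ[K] 1) * coproduct K n (word K n l)) =
        ((gen K n j * a) ⊗ₜ[K] 1) * coproduct K n (word K n l) := by
      rw [← mul_assoc]; simp
    rw [h1, map_add, closeUp_left, h2, ih, ih, ih, tr_mul_comm]
    simp [lmul, word_cons]

theorem closeUp_coproduct_right (l : List (Fin n)) : ∀ a : Ass K n,
    closeUp K n (coproduct K n (word K n l) * (a ⊗ₜ 1)) = tr K n a ⊗ₜ word K n l := by
  induction l using List.reverseRecOn with
  | nil => intro a; simp [word_nil, closeUp_tmul, closeAux, antipode_one,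
      Algebra.TensorProduct.one_def]
  | append_singleton l j ih =>
    intro a
    have h1 : coproduct K n (word K n (l ++ [j])) * (a ⊗ₜ[K] (1 : Ass K n)) =
        coproduct K n (word K n l) * ((gen K n j * a) ⊗ₜ[K] 1) +
        (coproduct K n (word K n l) * (a ⊗ₜ[K] 1)) * (1 ⊗ₜ[K] gen K n j) := by
      rw [word_append, word_single, map_mul, coproduct_gen, mul_assoc, mul_assoc, add_mul, mul_add]
      simp
    have h2 : (coproduct K n (word K n l) * (a ⊗ₜ[K] 1)) * (gen K n j ⊗ₜ[K] (1 : Ass K n)) =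
        coproduct K n (word K n l) * ((a * gen K n j) ⊗ₜ[K] 1) := by
      rw [mul_assoc]; simp
    rw [h1, map_add, closeUp_right, h2, ih, ih, ih, tr_mul_comm]
    simp [rmul, word_append, word_single]

/-- `∑ u ⊗ v` over the ways of writing a word as `u x_i v`. -/
def splitAt (i : Fin n) : List (Fin n) → Ass K n ⊗[K] Ass K n
  | [] => 0
  | j :: l => (if j = i then 1 ⊗ₜ word K n l else 0) + (gen K n j ⊗ₜ 1) * splitAt i l

theorem splitAt_append_single (i j : Fin n) (l : List (Fin n)) :
    splitAt K n i (l ++ [j]) =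
      (if j = i then word K n l ⊗ₜ 1 else 0) + splitAt K n i l * (1 ⊗ₜ gen K n j) := by
  induction l with
  | nil => simp [splitAt, word_nil]
  | cons k l ih =>
    simp only [List.cons_append, splitAt, ih, word_cons, word_append, add_mul, mul_add, mul_assoc]
    split_ifs <;> simp [add_left_comm, word_nil]

/-- The map `p ⊗ q ↦ |p x_i| ⊗ q - |p| ⊗ x_i q`. -/
def cutL (i : Fin n) : Ass K n ⊗[K] Ass K n →ₗ[K] Tr K n ⊗[K] Ass K n :=
  TensorProduct.map (tr K n ∘ₗ LinearMap.mulRight K (gen K n i)) LinearMap.id -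
    TensorProduct.map (tr K n) (LinearMap.mulLeft K (gen K n i))

/-- The map `p ⊗ q ↦ |q x_i| ⊗ p - |q| ⊗ p x_i`. -/
def cutR (i : Fin n) : Ass K n ⊗[K] Ass K n →ₗ[K] Tr K n ⊗[K] Ass K n :=
  (TensorProduct.map (tr K n ∘ₗ LinearMap.mulRight K (gen K n i)) LinearMap.id -
    TensorProduct.map (tr K n) (LinearMap.mulRight K (gen K n i))) ∘ₗ
      (TensorProduct.comm K (Ass K n) (Ass K n)).toLinearMap

theorem tensor_mul_neg (s t : Ass K n ⊗[K] Ass K n) : s * -t = -(s * t) :=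
  map_neg (LinearMap.mulLeft K s) t

theorem tensor_neg_mul (s t : Ass K n ⊗[K] Ass K n) : -s * t = -(s * t) :=
  map_neg (LinearMap.mulRight K t) s

theorem lTensor_left (f : Ass K n →ₗ[K] Ass K n) (a : Ass K n) (t : Ass K n ⊗[K] Ass K n) :
    LinearMap.lTensor (Ass K n) f ((a ⊗ₜ 1) * t) =
      (a ⊗ₜ 1) * LinearMap.lTensor (Ass K n) f t := by
  induction t with
  | zero => simp
  | add s t hs ht => simp only [mul_add, map_add, hs, ht]
  | tmul p q => simp

theorem lTensor_right (f : Ass K n →ₗ[K] Ass K n) (a : Ass K n) (t : Ass K n ⊗[K] Ass K n) :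
    LinearMap.lTensor (Ass K n) f (t * (a ⊗ₜ 1)) =
      LinearMap.lTensor (Ass K n) f t * (a ⊗ₜ 1) := by
  induction t with
  | zero => simp
  | add s t hs ht => simp only [add_mul, map_add, hs, ht]
  | tmul p q => simp

theorem lTensor_eta_left (i j : Fin n) (t : Ass K n ⊗[K] Ass K n) :
    LinearMap.lTensor (Ass K n) (etaBil K n (gen K n i)) ((1 ⊗ₜ gen K n j) * t) =
      if j = i then -((1 ⊗ₜ gen K n i) * t) else 0 := by
  induction t with
  | zero => simp
  | add s t hs ht =>
    simp only [mul_add, map_add, hs, ht]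
    split_ifs
    · abel
    · simp
  | tmul p q =>
    simp only [Algebra.TensorProduct.tmul_mul_tmul, LinearMap.lTensor_tmul, etaBil_gen_mul]
    split_ifs <;> simp [TensorProduct.tmul_neg]

theorem lTensor_eta_right (i j : Fin n) (t : Ass K n ⊗[K] Ass K n) :
    LinearMap.lTensor (Ass K n) ((etaBil K n).flip (gen K n i)) (t * (1 ⊗ₜ gen K n j)) =
      if j = i then -(t * (1 ⊗ₜ gen K n i)) else 0 := by
  induction t with
  | zero => simp
  | add s t hs ht =>
    simp only [add_mul, map_add, hs, ht]
    split_ifs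
    · abel
    · simp
  | tmul p q =>
    simp only [Algebra.TensorProduct.tmul_mul_tmul, LinearMap.lTensor_tmul, LinearMap.flip_apply,
      etaBil_mul_gen]
    split_ifs <;> simp [TensorProduct.tmul_neg]

theorem closeUp_eta_left (i : Fin n) (l : List (Fin n)) : ∀ a : Ass K n,
    closeUp K n ((a ⊗ₜ 1) * LinearMap.lTensor (Ass K n) (etaBil K n (gen K n i))
      (coproduct K n (word K n l))) = cutL K n i ((a ⊗ₜ 1) * splitAt K n i l) := by
  induction l with
  | nil =>
    intro a
    have : etaBil K n (gen K n i) 1 = 0 := by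
      rw [← word_nil, etaBil_gen_word]; simp [etaWord]
    simp [word_nil, splitAt, Algebra.TensorProduct.one_def, this]
  | cons j l ih =>
    intro a
    have h1 : (a ⊗ₜ[K] (1 : Ass K n)) * splitAt K n i (j :: l) =
        (if j = i then a ⊗ₜ[K] word K n l else 0) +
          ((a * gen K n j) ⊗ₜ[K] 1) * splitAt K n i l := by
      rw [splitAt, mul_add, ← mul_assoc]
      split_ifs <;> simp
    have h2 : (a ⊗ₜ[K] (1 : Ass K n)) * LinearMap.lTensor (Ass K n) (etaBil K n (gen K n i))
        (coproduct K n (word K n (j :: l))) =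
        ((a * gen K n j) ⊗ₜ[K] 1) * LinearMap.lTensor (Ass K n) (etaBil K n (gen K n i))
          (coproduct K n (word K n l)) +
        if j = i then -((1 ⊗ₜ[K] gen K n i) * ((a ⊗ₜ[K] 1) * coproduct K n (word K n l)))
          else 0 := by
      rw [word_cons, map_mul, coproduct_gen, add_mul, map_add, lTensor_left, lTensor_eta_left,
        mul_add, ← mul_assoc]
      split_ifs
      · rw [tensor_mul_neg, ← mul_assoc, ← mul_assoc]; simp
      · simp
    have h3 : (gen K n i ⊗ₜ[K] (1 : Ass K n)) * ((a ⊗ₜ[K] 1) * coproduct K n (word K n l)) =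
        ((gen K n i * a) ⊗ₜ[K] 1) * coproduct K n (word K n l) := by
      rw [← mul_assoc]; simp
    rw [h1, h2, map_add, map_add, ih, add_comm]
    congr 1
    split_ifs
    · rw [map_neg, closeUp_left, h3, closeUp_coproduct_left, closeUp_coproduct_left]
      simp [cutL, lmul, tr_mul_comm K n (gen K n i) a, sub_eq_add_neg, add_comm]
    · simp

theorem closeUp_eta_right (i : Fin n) (l : List (Fin n)) : ∀ a : Ass K n,
    closeUp K n (LinearMap.lTensor (Ass K n) ((etaBil K n).flip (gen K n i))
      (coproduct K n (word K n l)) * (a ⊗ₜ 1)) = cutR K n i (splitAt K n i l * (1 ⊗ₜ a)) := by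
  induction l using List.reverseRecOn with
  | nil =>
    intro a
    have : etaBil K n 1 (gen K n i) = 0 := by
      rw [← word_single, ← word_nil, etaBil, onWords_word, onWords_word]; simp [etaWord]
    simp [word_nil, splitAt, Algebra.TensorProduct.one_def, this]
  | append_singleton l j ih =>
    intro a
    have h1 : splitAt K n i (l ++ [j]) * ((1 : Ass K n) ⊗ₜ[K] a) =
        (if j = i then word K n l ⊗ₜ[K] a else 0) +
          splitAt K n i l * (1 ⊗ₜ[K] (gen K n j * a)) := by
      rw [splitAt_append_single, add_mul, mul_assoc]
      split_ifs <;> simp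
    have h2 : LinearMap.lTensor (Ass K n) ((etaBil K n).flip (gen K n i))
        (coproduct K n (word K n (l ++ [j]))) * (a ⊗ₜ[K] (1 : Ass K n)) =
        LinearMap.lTensor (Ass K n) ((etaBil K n).flip (gen K n i))
          (coproduct K n (word K n l)) * ((gen K n j * a) ⊗ₜ[K] 1) +
        if j = i then -((coproduct K n (word K n l) * (a ⊗ₜ[K] 1)) * (1 ⊗ₜ[K] gen K n i))
          else 0 := by
      rw [word_append, word_single, map_mul, coproduct_gen, mul_add, map_add, lTensor_right,
        lTensor_eta_right, add_mul, mul_assoc]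
      split_ifs
      · rw [tensor_neg_mul, mul_assoc, mul_assoc]; simp
      · simp
    have h3 : (coproduct K n (word K n l) * (a ⊗ₜ[K] 1)) * (gen K n i ⊗ₜ[K] (1 : Ass K n)) =
        coproduct K n (word K n l) * ((a * gen K n i) ⊗ₜ[K] 1) := by
      rw [mul_assoc]; simp
    rw [h1, h2, map_add, map_add, ih, add_comm]
    congr 1
    split_ifs
    · rw [map_neg, closeUp_right, h3, closeUp_coproduct_right, closeUp_coproduct_right]
      simp [cutR, rmul, sub_eq_add_neg, add_comm]
    · simp

theorem murGr_gen_mul (i : Fin n) (a : Ass K n) :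
    murGr K n (gen K n i * a) = lmul K n i (murGr K n a) +
      closeUp K n (LinearMap.lTensor (Ass K n) (etaBil K n (gen K n i)) (coproduct K n a)) := by
  have h : ∀ t : Ass K n ⊗[K] Ass K n,
      LinearMap.lTensor (Ass K n) (muGr K n) ((1 ⊗ₜ gen K n i) * t) =
        (1 ⊗ₜ gen K n i) * LinearMap.lTensor (Ass K n) (muGr K n) t +
          LinearMap.lTensor (Ass K n) (etaBil K n (gen K n i)) t := by
    intro t
    induction t with
    | zero => simp
    | add s t hs ht => simp only [mul_add, map_add, hs, ht]; abel
    | tmul p q => simp [muGr_gen_mul, TensorProduct.tmul_add]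
  simp only [murGr, LinearMap.comp_apply, AlgHom.toLinearMap_apply, map_mul, coproduct_gen,
    add_mul, map_add, lTensor_left, h, closeUp_left]
  abel

theorem murGr_mul_gen (i : Fin n) (a : Ass K n) :
    murGr K n (a * gen K n i) = rmul K n i (murGr K n a) +
      closeUp K n
        (LinearMap.lTensor (Ass K n) ((etaBil K n).flip (gen K n i)) (coproduct K n a)) := by
  have h : ∀ t : Ass K n ⊗[K] Ass K n,
      LinearMap.lTensor (Ass K n) (muGr K n) (t * (1 ⊗ₜ gen K n i)) =
        LinearMap.lTensor (Ass K n) (muGr K n) t * (1 ⊗ₜ gen K n i) +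
          LinearMap.lTensor (Ass K n) ((etaBil K n).flip (gen K n i)) t := by
    intro t
    induction t with
    | zero => simp
    | add s t hs ht => simp only [add_mul, map_add, hs, ht]; abel
    | tmul p q => simp [muGr_mul_gen, TensorProduct.tmul_add]
  simp only [murGr, LinearMap.comp_apply, AlgHom.toLinearMap_apply, map_mul, coproduct_gen,
    mul_add, map_add, lTensor_right, h, closeUp_right]
  abel

theorem tr_lmul_eq_tr_rmul (i : Fin n) (t : Tr K n ⊗[K] Ass K n) :
    LinearMap.lTensor (Tr K n) (tr K n) (lmul K n i t) =
      LinearMap.lTensor (Tr K n) (tr K n) (rmul K n i t) := by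
  induction t with
  | zero => simp
  | add s t hs ht => simp only [map_add, hs, ht]
  | tmul p q => simp [lmul, rmul, tr_mul_comm K n q]

theorem alt_cut (i : Fin n) (t : Ass K n ⊗[K] Ass K n) :
    alt K (Tr K n) (LinearMap.lTensor (Tr K n) (tr K n) (cutL K n i t)) =
      alt K (Tr K n) (LinearMap.lTensor (Tr K n) (tr K n) (cutR K n i t)) := by
  induction t with
  | zero => simp
  | add s t hs ht => simp only [map_add, hs, ht]
  | tmul p q =>
    simp [alt, cutL, cutR, tr_mul_comm K n q]
    abel

theorem deltaLift_gen_mul (i : Fin n) (a : Ass K n) :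
    deltaLift K n (gen K n i * a) = deltaLift K n (a * gen K n i) := by
  have : deltaLift K n ∘ₗ LinearMap.mulLeft K (gen K n i) =
      deltaLift K n ∘ₗ LinearMap.mulRight K (gen K n i) := by
    refine ext_words K n fun l => ?_
    have hl := closeUp_eta_left K n i l 1
    have hr := closeUp_eta_right K n i l 1
    rw [← Algebra.TensorProduct.one_def, one_mul, one_mul] at hl
    rw [← Algebra.TensorProduct.one_def, mul_one, mul_one] at hr
    simp only [deltaLift, LinearMap.comp_apply, LinearMap.mulLeft_apply,
      LinearMap.mulRight_apply, murGr_gen_mul, murGr_mul_gen, map_add, hl, hr, alt_cut,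
      tr_lmul_eq_tr_rmul]
  exact LinearMap.congr_fun this a

theorem deltaLift_mul_comm (a b : Ass K n) :
    deltaLift K n (a * b) = deltaLift K n (b * a) := by
  induction a using FreeAlgebra.induction generalizing b with
  | grade0 r => rw [Algebra.commutes]
  | grade1 i => exact deltaLift_gen_mul K n i b
  | mul a c ha hc => rw [mul_assoc, ha, mul_assoc, hc, mul_assoc]
  | add a c ha hc => rw [add_mul, mul_add, map_add, map_add, ha, hc]

end descent

/-- The linearized framed Turaev cobracket `δ^f_gr : tr_n → tr_n ⊗ tr_n`, determined by
`δ^f_gr(|a|) = (Alt ∘ (id ⊗ | |) ∘ μ^f_{r,gr})(a)`. -/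
def deltaGr : Tr K n →ₗ[K] Tr K n ⊗[K] Tr K n :=
  (commutators K n).liftQ (deltaLift K n) <| Submodule.span_le.2 <| by
    rintro _ ⟨a, b, rfl⟩
    simp [deltaLift_mul_comm K n a b]

theorem deltaGr_tr (a : Ass K n) : deltaGr K n (tr K n a) = deltaLift K n a := rfl

/-! ### Tangential derivations -/

/-- The canonical map `lie_n → ass_n` from the free Lie algebra, sending generators to
generators. -/
def lieToAss : FreeLieAlgebra K (Fin n) →ₗ⁅K⁆ Ass K n := FreeLieAlgebra.lift K (gen K n)

/-- `tder_n = lie_n^{⊕ n}`: the tangential derivations `(u_1, …, u_n)`. -/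
abbrev TDer : Type _ := Fin n → FreeLieAlgebra K (Fin n)

variable {K n}

/-- The algebra map `a ↦ (a, ρ(u)(a))` to the trivial square-zero extension of `ass_n` by
itself. -/
def rhoAux (u : TDer K n) : Ass K n →ₐ[K] TrivSqZeroExt (Ass K n) (Ass K n) :=
  FreeAlgebra.lift K fun i =>
    TrivSqZeroExt.inl (gen K n i) + TrivSqZeroExt.inr ⁅gen K n i, lieToAss K n (u i)⁆

/-- The action of `u = (u_1, …, u_n)` on `ass_n`: the derivation with `ρ(u)(x_i) = [x_i, u_i]`. -/
def rho (u : TDer K n) : Ass K n →ₗ[K] Ass K n :=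
  { toFun := fun a => (rhoAux u a).snd
    map_add' := by simp
    map_smul' := by simp }

theorem rho_gen (u : TDer K n) (i : Fin n) :
    rho u (gen K n i) = ⁅gen K n i, lieToAss K n (u i)⁆ := by
  simp [rho, rhoAux]

theorem rho_mul (u : TDer K n) (a b : Ass K n) :
    rho u (a * b) = rho u a * b + a * rho u b := by
  have h : ∀ c, (rhoAux u c).fst = c := by
    intro c
    have : (TrivSqZeroExt.fstHom K (Ass K n) (Ass K n)).comp (rhoAux u) = AlgHom.id K _ := by
      ext i; simp [rhoAux]
    exact DFunLike.congr_fun this c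
  simp [rho, h, add_comm]

/-- The action of `u` on `tr_n`, induced by `ρ(u)`. -/
def rhoTr (u : TDer K n) : Tr K n →ₗ[K] Tr K n :=
  (commutators K n).liftQ (tr K n ∘ₗ rho u) <| Submodule.span_le.2 <| by
    rintro _ ⟨a, b, rfl⟩
    simp [rho_mul, tr_mul_comm K n (rho u a), tr_mul_comm K n a, add_comm]

theorem rhoTr_tr (u : TDer K n) (a : Ass K n) : rhoTr u (tr K n a) = tr K n (rho u a) := rfl

/-- The action `D ⊗ id + id ⊗ D` on `V ⊗ V` induced by an endomorphism `D` of `V`. -/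
def tensorAct {V : Type*} [AddCommGroup V] [Module K V] (D : V →ₗ[K] V) :
    V ⊗[K] V →ₗ[K] V ⊗[K] V :=
  LinearMap.rTensor V D + LinearMap.lTensor V D

/-! ### Divergence and the Kashiwara–Vergne Lie algebras -/

variable (K n)

/-- On words: `∂_i (a_1 ⋯ a_m) = a_1 ⋯ a_{m-1}` if `a_m = x_i`, and `0` otherwise. -/
def partialWord (i : Fin n) (w : List (Fin n)) : Ass K n :=
  if w.getLast? = some i then word K n w.dropLast else 0

/-- The operators `∂_i` with `a = ε(a) + ∑_i (∂_i a) x_i`. -/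
def partialD (i : Fin n) : Ass K n →ₗ[K] Ass K n := onWords K n (partialWord K n i)

variable {K n}

/-- The divergence `div(u) = ∑_i |x_i (∂_i u_i)|`. -/
def divergence (u : TDer K n) : Tr K n :=
  ∑ i, tr K n (gen K n i * partialD K n i (lieToAss K n (u i)))

variable (K n)

/-- The part of `tr_n` of degree at least `N`: the span of the cyclic words of length `≥ N`. -/
def trGE (N : ℕ) : Submodule K (Tr K n) :=
  Submodule.span K {t | ∃ l : List (Fin n), N ≤ l.length ∧ t = tr K n (word K n l)}

/-- The special derivations: `u` with `ρ(u)(x_0) = 0`. -/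
def sder : Set (TDer K n) := {u | rho u (gen₀ K n) = 0}

/-- The Kashiwara–Vergne Lie algebra `krv_n`: the special derivations `u` such that
`div(u) = |f_0(x_0)| + ∑_{i=1}^n |f_i(x_i)|` for some formal power series `f_0, f_1, …, f_n`.
The equation is one in the degree completion of `tr_n`, that is, it holds modulo degree `≥ N`
for every `N`. -/
def krv : Set (TDer K n) :=
  {u | u ∈ sder K n ∧ ∃ (f₀ : PowerSeries K) (f : Fin n → PowerSeries K), ∀ N : ℕ,
    divergence u - (tr K n (Polynomial.aeval (gen₀ K n) (PowerSeries.trunc N f₀)) +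
      ∑ i, tr K n (Polynomial.aeval (gen K n i) (PowerSeries.trunc N (f i)))) ∈ trGE K n N}

/-- `krv_n^0`: the special derivations `u` such that `div(u)` is a linear combination of
`|x_1|, …, |x_n|`. -/
def krv₀ : Set (TDer K n) :=
  {u | u ∈ sder K n ∧ divergence u ∈ Submodule.span K (Set.range fun i => tr K n (gen K n i))}

end KV

end

/-
Write `r_i = ∂_i u_i - μ(u_i)`. The commutator of `ρ(u)` with `η_gr` is a Fox pairing, and its
values on letters vanish exactly when `ρ(u)(x_0) = 0`. For such `u` the commutator `D` of `ρ(u)`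
with `μ^f_gr` is a derivation with `D(x_i) = [x_i, r_i]`, and, since the coefficients of
`∑ x_i u_i` are invariant under cyclic rotation, the coefficient of `r_i` at `w` is the cyclic
coefficient of `div(u)` at `x_i w`. Away from the powers of `x_i`, which `D` does not see,

* `D = 0` means that the `r_i` vanish, that is, `div(u)` is linear;
* `u ∈ krv_n` means that the coefficient of `r_i` at `w` depends only on the length of `w`, and
  then `D` is inner, `D = [·, b]` with `b` a polynomial in `x_0`; the cobracket is unaffected by
  an inner modification of `μ^f_gr`.

Conversely, if `ρ(u)` commutes with `δ^f_gr`, applying the counit to one factor of `tr_n ⊗ tr_n`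
gives `|D(a)| = 0` for all `a`. Taking `a = x_i^N x_j^M` with large `N` and `M` shows that `r_i` and
`r_j` agree at the words that are powers neither of `x_i` nor of `x_j`, and cyclic invariance then
makes these coefficients depend on the length alone.
-/

noncomputable section

namespace KV

variable {K : Type*} [Field K] {n : ℕ}

attribute [local instance 100] LieRing.ofAssociativeRing

section Words

theorem span_range_word : Submodule.span K (Set.range (word K n)) = ⊤ := by
  rw [← (wordBasis K n).span_eq, ← FreeMonoid.toList.surjective.range_comp]
  congr 2
  exact funext fun w => (wordBasis_apply K n w).symm

theorem left_induction {p : Ass K n → Prop} (one : p 1) (gen_mul : ∀ i a, p a → p (gen K n i * a))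
    (add : ∀ a b, p a → p b → p (a + b)) (smul : ∀ (c : K) a, p a → p (c • a)) (a : Ass K n) :
    p a := by
  have ha : a ∈ Submodule.span K (Set.range (word K n)) := by
    rw [span_range_word]; exact Submodule.mem_top
  induction ha using Submodule.span_induction with
  | mem x h =>
    obtain ⟨l, rfl⟩ := h
    induction l with
    | nil => exact one
    | cons i l ih => rw [word_cons]; exact gen_mul _ _ ih
  | zero => simpa using smul 0 1 one
  | add x y _ _ hx hy => exact add x y hx hy
  | smul c x _ hx => exact smul c x hx

theorem right_induction {p : Ass K n → Prop} (one : p 1) (mul_gen : ∀ a i, p a → p (a * gen K n i))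
    (add : ∀ a b, p a → p b → p (a + b)) (smul : ∀ (c : K) a, p a → p (c • a)) (a : Ass K n) :
    p a := by
  have ha : a ∈ Submodule.span K (Set.range (word K n)) := by
    rw [span_range_word]; exact Submodule.mem_top
  induction ha using Submodule.span_induction with
  | mem x h =>
    obtain ⟨l, rfl⟩ := h
    induction l using List.reverseRecOn with
    | nil => exact one
    | append_singleton l i ih => rw [word_append, word_single]; exact mul_gen _ _ ih
  | zero => simpa using smul 0 1 one
  | add x y _ _ hx hy => exact add x y hx hy
  | smul c x _ hx => exact smul c x hx

/-- The coefficient of the word `l` in an element of `ass_n`. -/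
def coef (l : List (Fin n)) : Ass K n →ₗ[K] K := (wordBasis K n).coord (FreeMonoid.ofList l)

theorem coef_word (l m : List (Fin n)) : coef l (word K n m) = if m = l then 1 else 0 := by
  classical
  have hm : word K n m = wordBasis K n (FreeMonoid.ofList m) := by simp [wordBasis_apply]
  rw [hm, coef, Module.Basis.coord_apply, Module.Basis.repr_self, Finsupp.single_apply]
  simp

theorem map_mem_of_coef {V : Type*} [AddCommGroup V] [Module K V] (f : Ass K n →ₗ[K] V)
    (S : Submodule K V) (a : Ass K n) (h : ∀ l, coef l a ≠ 0 → f (word K n l) ∈ S) : f a ∈ S := by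
  rw [← (wordBasis K n).linearCombination_repr a, Finsupp.linearCombination_apply, Finsupp.sum,
    map_sum]
  refine S.sum_mem fun w hw => ?_
  rw [map_smul, wordBasis_apply]
  exact S.smul_mem _ (h _ (Finsupp.mem_support_iff.1 hw))

theorem exists_coef_eq_zero_of_le_length (a : Ass K n) :
    ∃ d, ∀ l : List (Fin n), d ≤ l.length → coef l a = 0 := by
  let length (w : FreeMonoid (Fin n)) : ℕ := (FreeMonoid.toList w).length
  refine ⟨((wordBasis K n).repr a).support.sup length + 1, fun l hl => ?_⟩
  by_contra h
  exact absurd (Finset.le_sup (f := length) (Finsupp.mem_support_iff.2 h)) (not_le.2 hl)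

theorem coef_one (l : List (Fin n)) : coef l (1 : Ass K n) = if l = [] then 1 else 0 := by
  rw [← word_nil, coef_word]
  simp only [eq_comm]

theorem coef_word_mul (l m : List (Fin n)) (a : Ass K n) :
    coef l (word K n m * a) = if m <+: l then coef (l.drop m.length) a else 0 := by
  have h : coef l ∘ₗ LinearMap.mulLeft K (word K n m) =
      if m <+: l then coef (l.drop m.length) else 0 := by
    refine ext_words K n fun p => ?_
    rw [LinearMap.comp_apply, LinearMap.mulLeft_apply, ← word_append, coef_word]
    split_ifs with h₁ h₂ h₂
    · simp [← h₁, coef_word]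
    · exact absurd ⟨p, h₁⟩ h₂
    · obtain ⟨q, rfl⟩ := h₂
      simp_all [coef_word]
    · simp
  rw [← LinearMap.mulLeft_apply (R := K), ← LinearMap.comp_apply, h]
  split_ifs <;> simp

theorem coef_mul_word (l m : List (Fin n)) (a : Ass K n) :
    coef l (a * word K n m) =
      if m <:+ l then coef (l.take (l.length - m.length)) a else 0 := by
  have h : coef l ∘ₗ LinearMap.mulRight K (word K n m) =
      if m <:+ l then coef (l.take (l.length - m.length)) else 0 := by
    refine ext_words K n fun p => ?_
    rw [LinearMap.comp_apply, LinearMap.mulRight_apply, ← word_append, coef_word]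
    split_ifs with h₁ h₂ h₂
    · simp [← h₁, coef_word]
    · exact absurd ⟨p, h₁⟩ h₂
    · obtain ⟨q, rfl⟩ := h₂
      simp_all [coef_word]
    · simp
  rw [← LinearMap.mulRight_apply (R := K), ← LinearMap.comp_apply, h]
  split_ifs <;> simp

theorem coef_cons_gen_mul (i j : Fin n) (l : List (Fin n)) (a : Ass K n) :
    coef (i :: l) (gen K n j * a) = if j = i then coef l a else 0 := by
  rw [← word_single, coef_word_mul]
  simp

theorem coef_concat_mul_gen (i j : Fin n) (l : List (Fin n)) (a : Ass K n) :
    coef (l ++ [i]) (a * gen K n j) = if j = i then coef l a else 0 := by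
  rw [← word_single, coef_mul_word]
  simp [List.singleton_suffix_append_singleton_iff]

theorem coef_cons_sum (f : Fin n → Ass K n) (i : Fin n) (l : List (Fin n)) :
    coef (i :: l) (∑ j, gen K n j * f j) = coef l (f i) := by
  simp [map_sum, coef_cons_gen_mul]

theorem coef_concat_sum (f : Fin n → Ass K n) (i : Fin n) (l : List (Fin n)) :
    coef (l ++ [i]) (∑ j, f j * gen K n j) = coef l (f i) := by
  simp [map_sum, coef_concat_mul_gen]

/-- The counit of the Hopf algebra `ass_n`: the algebra map to `K` that kills the generators. -/
def counit : Ass K n →ₐ[K] K := FreeAlgebra.lift K 0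

@[simp]
theorem counit_gen (i : Fin n) : counit (gen K n i) = 0 := by simp [counit]

@[simp]
theorem counit_gen₀ : counit (gen₀ K n) = 0 := by simp [gen₀]

theorem coef_nil (a : Ass K n) : coef [] a = counit a := by
  have h : coef [] = (counit (K := K) (n := n)).toLinearMap := ext_words K n fun l => by
    rw [coef_word]; cases l <;> simp [word_nil, word_cons]
  exact LinearMap.congr_fun h a

theorem gen_pow_eq_word (i : Fin n) (m : ℕ) :
    gen K n i ^ m = word K n (List.replicate m i) := by
  simp [word]

theorem coef_gen_pow (i : Fin n) (m : ℕ) (l : List (Fin n)) :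
    coef l (gen K n i ^ m) = if l = List.replicate m i then 1 else 0 := by
  rw [gen_pow_eq_word, coef_word]
  simp only [eq_comm]

theorem coef_gen₀_pow (m : ℕ) (l : List (Fin n)) :
    coef l (gen₀ K n ^ m) = if l.length = m then 1 else 0 := by
  induction m generalizing l with
  | zero => simp [coef_one]
  | succ m ih =>
    cases l with
    | nil => simp [coef_nil]
    | cons i l => rw [pow_succ', gen₀, Finset.sum_mul, coef_cons_sum, ← gen₀, ih]; simp

theorem commute_gen_iff (i : Fin n) (q : Ass K n) :
    Commute (gen K n i) q ↔ ∀ l : List (Fin n), l ≠ List.replicate l.length i → coef l q = 0 := by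
  constructor
  · intro h l hl
    have hpow := congrArg (coef (List.replicate l.length i ++ l)) (h.pow_left l.length).eq
    rw [gen_pow_eq_word, coef_word_mul, coef_mul_word, if_pos (List.prefix_append _ _),
      List.drop_left, if_neg] at hpow
    · exact hpow
    · intro hs
      refine hl (List.IsSuffix.eq_of_length ?_ (by simp)).symm
      exact List.suffix_of_suffix_length_le hs (List.suffix_append _ _) (by simp)
  · intro h
    refine sub_eq_zero.1 (map_mem_of_coef
      (LinearMap.mulLeft K (gen K n i) - LinearMap.mulRight K (gen K n i)) ⊥ q fun l hl => ?_)
    rw [not_imp_comm.1 (h l) hl, ← gen_pow_eq_word]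
    exact sub_eq_zero.2 (Commute.self_pow _ _).eq

end Words

section Derivations

/-- Leibniz's rule `d (ab) = (d a) b + a (d b)` for an endomorphism of a possibly noncommutative
algebra, to which Mathlib's `Derivation` does not apply. -/
def IsDerivation {A : Type*} [Ring A] [Algebra K A] (d : A →ₗ[K] A) : Prop :=
  ∀ a b, d (a * b) = d a * b + a * d b

namespace IsDerivation

variable {A : Type*} [Ring A] [Algebra K A] {d e : A →ₗ[K] A}

theorem map_one (hd : IsDerivation d) : d 1 = 0 := by simpa using hd 1 1

theorem map_pow_of_map_eq_commutator (hd : IsDerivation d) {x r : A} (hx : d x = x * r - r * x)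
    (m : ℕ) : d (x ^ m) = x ^ m * r - r * x ^ m := by
  induction m with
  | zero => simp [hd.map_one]
  | succ m ih =>
    rw [pow_succ, hd, ih, hx]
    noncomm_ring

theorem lTensor (hd : IsDerivation d) : IsDerivation (LinearMap.lTensor A d) := by
  intro s t
  induction s with
  | zero => simp
  | add x y hx hy => simp only [add_mul, map_add, hx, hy]; abel
  | tmul a b =>
    induction t with
    | zero => simp
    | add x y hx hy => simp only [mul_add, map_add, hx, hy]; abel
    | tmul c e => simp [hd b e, TensorProduct.tmul_add]

theorem rTensor (hd : IsDerivation d) : IsDerivation (LinearMap.rTensor A d) := by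
  intro s t
  induction s with
  | zero => simp
  | add x y hx hy => simp only [add_mul, map_add, hx, hy]; abel
  | tmul a b =>
    induction t with
    | zero => simp
    | add x y hx hy => simp only [mul_add, map_add, hx, hy]; abel
    | tmul c e => simp [hd a c, TensorProduct.add_tmul]

theorem tensorAct (hd : IsDerivation d) : IsDerivation (tensorAct d) := by
  intro s t
  simp only [KV.tensorAct, LinearMap.add_apply, hd.lTensor s t, hd.rTensor s t, add_mul, mul_add]
  abel

theorem ext_gen {d e : Ass K n →ₗ[K] Ass K n} (hd : IsDerivation d) (he : IsDerivation e)
    (h : ∀ i, d (gen K n i) = e (gen K n i)) : d = e := by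
  refine LinearMap.ext fun a => ?_
  induction a using FreeAlgebra.induction with
  | grade0 r => simp [Algebra.algebraMap_eq_smul_one, hd.map_one, he.map_one]
  | grade1 i => exact h i
  | mul a b ha hb => rw [hd, he, ha, hb]
  | add a b ha hb => rw [map_add, map_add, ha, hb]

end IsDerivation

/-- The inner derivation `a ↦ [a, b]`. -/
def innerDerivation {A : Type*} [Ring A] [Algebra K A] (b : A) : A →ₗ[K] A :=
  LinearMap.mulRight K b - LinearMap.mulLeft K b

theorem innerDerivation_apply {A : Type*} [Ring A] [Algebra K A] (a b : A) :
    innerDerivation (K := K) b a = a * b - b * a := rfl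

theorem isDerivation_innerDerivation {A : Type*} [Ring A] [Algebra K A] (b : A) :
    IsDerivation (innerDerivation (K := K) b) := by
  intro x y
  simp only [innerDerivation_apply]
  noncomm_ring

end Derivations

section FoxPairings

/-- Fox pairings on `ass_n`: bilinear forms with values in `ass_n` that satisfy the Leibniz rule
of a left Fox derivative in the first variable and of a right one in the second. -/
structure IsFoxPairing (B : Ass K n →ₗ[K] Ass K n →ₗ[K] Ass K n) : Prop where
  mul_left : ∀ a b c, B (a * b) c = a * B b c + counit b • B a c
  mul_right : ∀ a b c, B a (b * c) = B a b * c + counit b • B a c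

namespace IsFoxPairing

variable {B : Ass K n →ₗ[K] Ass K n →ₗ[K] Ass K n}

theorem one_left (hB : IsFoxPairing B) (a : Ass K n) : B 1 a = 0 := by
  simpa using hB.mul_left 1 1 a

theorem one_right (hB : IsFoxPairing B) (a : Ass K n) : B a 1 = 0 := by
  simpa using hB.mul_right a 1 1

theorem eq_zero (hB : IsFoxPairing B) (h : ∀ i j, B (gen K n i) (gen K n j) = 0) : B = 0 := by
  refine LinearMap.ext₂ fun a b => ?_
  induction a using FreeAlgebra.induction generalizing b with
  | grade0 r => simp [Algebra.algebraMap_eq_smul_one, hB.one_left]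
  | mul a c ha hc => simp [hB.mul_left, ha, hc]
  | add a c ha hc => simp [ha, hc]
  | grade1 i =>
    induction b using FreeAlgebra.induction with
    | grade0 r => simp [Algebra.algebraMap_eq_smul_one, hB.one_right]
    | mul b c hb hc => simp_all [hB.mul_right]
    | add b c hb hc => simp_all
    | grade1 j => exact h i j

end IsFoxPairing

theorem etaBil_one_left (a : Ass K n) : etaBil K n 1 a = 0 := by
  have h : etaBil K n 1 = 0 := ext_words K n fun l => by
    rw [← word_nil, etaBil, onWords_word, onWords_word]
    simp [etaWord]
  rw [h, LinearMap.zero_apply]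

theorem etaBil_one_right (a : Ass K n) : etaBil K n a 1 = 0 := by
  have h : (etaBil K n).flip 1 = 0 := ext_words K n fun l => by
    rw [LinearMap.flip_apply, ← word_nil, etaBil, onWords_word, onWords_word]
    cases hl : l.getLast? <;> simp [etaWord, hl]
  rw [← LinearMap.flip_apply, h, LinearMap.zero_apply]

theorem etaBil_mul_gen_gen_mul (i j : Fin n) (a b : Ass K n) :
    etaBil K n (a * gen K n i) (gen K n j * b) =
      if j = i then -(a * gen K n i * b) else 0 := by
  have h : (etaBil K n ∘ₗ LinearMap.mulRight K (gen K n i)).compl₂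
      (LinearMap.mulLeft K (gen K n j)) =
      if j = i then -(LinearMap.mul K (Ass K n) ∘ₗ LinearMap.mulRight K (gen K n i)) else 0 := by
    refine ext_words K n fun l => ext_words K n fun m => ?_
    rw [LinearMap.compl₂_apply, LinearMap.comp_apply, LinearMap.mulLeft_apply,
      LinearMap.mulRight_apply, ← word_cons, ← word_single, ← word_append, etaBil, onWords_word,
      onWords_word]
    by_cases hj : j = i
    · simp [hj, etaWord, zz, word_single]
    · simp [hj, etaWord, zz, Ne.symm hj]
  have hab := LinearMap.congr_fun₂ h a b
  simp only [LinearMap.compl₂_apply, LinearMap.comp_apply, LinearMap.mulLeft_apply,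
    LinearMap.mulRight_apply] at hab
  rw [hab]
  split_ifs <;> simp

theorem isFoxPairing_etaBil : IsFoxPairing (etaBil K n) where
  mul_left a b c := by
    induction b using right_induction with
    | one => simp [etaBil_one_left]
    | add x y hx hy => simp only [mul_add, map_add, LinearMap.add_apply, hx, hy, add_smul]; abel
    | smul r x hx => simp only [mul_smul_comm, map_smul, LinearMap.smul_apply, hx, smul_add,
        smul_assoc]
    | mul_gen b i ih =>
      clear ih
      rw [map_mul counit, counit_gen, mul_zero, zero_smul, add_zero, ← mul_assoc]
      induction c using left_induction with
      | one => simp [etaBil_one_right]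
      | add x y hx hy => simp only [mul_add, map_add, hx, hy]
      | smul r x hx => simp only [mul_smul_comm, map_smul, hx]
      | gen_mul j c _ =>
        rw [etaBil_mul_gen_gen_mul, etaBil_mul_gen_gen_mul]
        split_ifs <;> simp [mul_assoc]
  mul_right a b c := by
    induction b using left_induction with
    | one => simp [etaBil_one_right]
    | add x y hx hy => simp only [add_mul, map_add, hx, hy, add_smul]; abel
    | smul r x hx => simp only [smul_mul_assoc, map_smul, hx, smul_add, smul_assoc]
    | gen_mul i b ih =>
      clear ih
      rw [map_mul counit, counit_gen, zero_mul, zero_smul, add_zero, mul_assoc]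
      induction a using right_induction with
      | one => simp [etaBil_one_left]
      | add x y hx hy => simp only [add_mul, map_add, LinearMap.add_apply, hx, hy]
      | smul r x hx => simp only [smul_mul_assoc, map_smul, LinearMap.smul_apply, hx]
      | mul_gen a j _ =>
        rw [etaBil_mul_gen_gen_mul, etaBil_mul_gen_gen_mul]
        split_ifs <;> simp [mul_assoc]

theorem etaBil_gen_gen (i j : Fin n) :
    etaBil K n (gen K n i) (gen K n j) = if j = i then -gen K n i else 0 := by
  simpa using etaBil_gen_mul K n i j 1

theorem etaBil_gen_sum (f : Fin n → Ass K n) (i : Fin n) :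
    etaBil K n (gen K n i) (∑ j, gen K n j * f j) = -(gen K n i * f i) := by
  simp [map_sum, etaBil_gen_mul]

theorem etaBil_sum_gen (f : Fin n → Ass K n) (i : Fin n) :
    etaBil K n (∑ j, f j * gen K n j) (gen K n i) = -(f i * gen K n i) := by
  simp [map_sum, LinearMap.sum_apply, etaBil_mul_gen]

theorem etaBil_gen₀_left (a : Ass K n) : etaBil K n (gen₀ K n) a = counit a • 1 - a := by
  induction a using left_induction with
  | one => simp [etaBil_one_right]
  | add x y hx hy => simp only [map_add, hx, hy, add_smul]; abel
  | smul r x hx => simp only [map_smul, hx, smul_sub, smul_assoc]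
  | gen_mul i a => simp [gen₀, LinearMap.sum_apply, etaBil_gen_mul]

theorem etaBil_gen₀_right (a : Ass K n) : etaBil K n a (gen₀ K n) = counit a • 1 - a := by
  induction a using right_induction with
  | one => simp [etaBil_one_left]
  | add x y hx hy => simp only [map_add, LinearMap.add_apply, hx, hy, add_smul]; abel
  | smul r x hx => simp only [map_smul, LinearMap.smul_apply, hx, smul_sub, smul_assoc]
  | mul_gen a i => simp [gen₀, etaBil_mul_gen]

end FoxPairings

section Mu

theorem muGr_gen (i : Fin n) : muGr K n (gen K n i) = 0 := by
  rw [← word_single, muGr, onWords_word, muWord]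

theorem muGr_one : muGr K n 1 = 0 := by
  rw [← word_nil, muGr, onWords_word, muWord]

theorem muGr_mul (a b : Ass K n) :
    muGr K n (a * b) = a * muGr K n b + muGr K n a * b + etaBil K n a b := by
  induction a using left_induction generalizing b with
  | one => simp [muGr_one, etaBil_one_left]
  | add x y hx hy => simp only [add_mul, map_add, LinearMap.add_apply, hx, hy]; abel
  | smul r x hx => simp only [smul_mul_assoc, map_smul, LinearMap.smul_apply, hx, smul_add]
  | gen_mul i a ih =>
    rw [mul_assoc, muGr_gen_mul, ih, muGr_gen_mul, isFoxPairing_etaBil.mul_left,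
      isFoxPairing_etaBil.mul_right]
    noncomm_ring

theorem partialD_word (i : Fin n) (l : List (Fin n)) :
    partialD K n i (word K n l) = partialWord K n i l := by
  rw [partialD, onWords_word]

theorem etaBil_gen_right (a : Ass K n) (i : Fin n) :
    etaBil K n a (gen K n i) = -(partialD K n i a * gen K n i) := by
  have h : (etaBil K n).flip (gen K n i) =
      -(LinearMap.mulRight K (gen K n i) ∘ₗ partialD K n i) := ext_words K n fun l => by
    induction l using List.reverseRecOn with
    | nil =>
      rw [LinearMap.flip_apply, LinearMap.neg_apply, LinearMap.comp_apply, partialD_word]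
      simp [partialWord, word_nil, etaBil_one_left]
    | append_singleton l j =>
      rw [LinearMap.flip_apply, LinearMap.neg_apply, LinearMap.comp_apply, partialD_word,
        word_append, word_single, etaBil_mul_gen]
      by_cases hj : j = i <;> simp [partialWord, hj]
  exact LinearMap.congr_fun h a

theorem coef_partialD (i : Fin n) (l : List (Fin n)) (a : Ass K n) :
    coef l (partialD K n i a) = coef (l ++ [i]) a := by
  have h : coef l ∘ₗ partialD K n i = coef (l ++ [i]) := ext_words K n fun m => by
    induction m using List.reverseRecOn with
    | nil => simp [partialD_word, partialWord, coef_word]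
    | append_singleton m j =>
      rw [LinearMap.comp_apply, partialD_word]
      by_cases hj : j = i <;> simp [partialWord, coef_word, hj]
  exact LinearMap.congr_fun h a

/-- The word on the right-hand side is `l` with its `k`-th letter doubled. -/
theorem coef_muGr (l : List (Fin n)) (a : Ass K n) :
    coef l (muGr K n a) =
      -∑ k ∈ Finset.range l.length, coef (l.take (k + 1) ++ l.drop k) a := by
  induction a using right_induction generalizing l with
  | one => cases l <;> simp [muGr_one, coef_one]
  | add x y hx hy => simp only [map_add, hx, hy, Finset.sum_add_distrib, neg_add]
  | smul r x hx => simp only [map_smul, hx, smul_neg, Finset.smul_sum]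
  | mul_gen a i ih =>
    rw [muGr_mul_gen, etaBil_gen_right, ← sub_eq_add_neg, ← sub_mul]
    induction l using List.reverseRecOn with
    | nil => simp [coef_nil]
    | append_singleton l c =>
      have hk : ∀ k ∈ Finset.range l.length,
          coef ((l ++ [c]).take (k + 1) ++ (l ++ [c]).drop k) (a * gen K n i) =
            if i = c then coef (l.take (k + 1) ++ l.drop k) a else 0 := fun k hk => by
        have hk : k < l.length := Finset.mem_range.1 hk
        rw [List.take_append_of_le_length hk, List.drop_append_of_le_length hk.le,
          ← List.append_assoc, coef_concat_mul_gen]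
      rw [List.length_append, List.length_singleton, Finset.sum_range_succ, Finset.sum_congr rfl hk,
        List.take_of_length_le (by simp), List.drop_left, coef_concat_mul_gen, coef_concat_mul_gen,
        map_sub, ih, coef_partialD]
      split_ifs with h
      · rw [h]; ring
      · simp

end Mu

section LieElements

theorem lieToAss_induction {p : Ass K n → Prop} (gen : ∀ i, p (gen K n i)) (zero : p 0)
    (add : ∀ a b, p a → p b → p (a + b)) (smul : ∀ (c : K) a, p a → p (c • a))
    (lie : ∀ a b, p a → p b → p (a * b - b * a)) (f : FreeLieAlgebra K (Fin n)) :
    p (lieToAss K n f) := by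
  let S : LieSubalgebra K (Ass K n) :=
    { carrier := {a | p a}
      add_mem' := fun ha hb => add _ _ ha hb
      zero_mem' := zero
      smul_mem' := fun c _ ha => smul c _ ha
      lie_mem' := fun ha hb => by
        rw [LieRing.of_associative_ring_bracket]; exact lie _ _ ha hb }
  let g : FreeLieAlgebra K (Fin n) →ₗ⁅K⁆ S := FreeLieAlgebra.lift K fun i => ⟨_, gen i⟩
  have h : lieToAss K n = S.incl.comp g := by
    refine FreeLieAlgebra.hom_ext fun i => ?_
    simp [lieToAss, g]
  rw [h]
  exact (g f).2

variable (f : FreeLieAlgebra K (Fin n))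

theorem counit_lieToAss : counit (lieToAss K n f) = 0 := by
  refine lieToAss_induction (p := fun a => counit a = 0) counit_gen (map_zero _) ?_ ?_ ?_ f
  · intro a b ha hb; rw [map_add, ha, hb, add_zero]
  · intro c a ha; rw [map_smul, ha, smul_zero]
  · intro a b ha hb; rw [map_sub, map_mul, map_mul, ha, hb, sub_self]

theorem coproduct_lieToAss :
    coproduct K n (lieToAss K n f) = lieToAss K n f ⊗ₜ 1 + 1 ⊗ₜ lieToAss K n f := by
  refine lieToAss_induction (p := fun a => coproduct K n a = a ⊗ₜ 1 + 1 ⊗ₜ a)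
    (coproduct_gen K n) (by simp) ?_ ?_ ?_ f
  · intro a b ha hb
    rw [map_add, ha, hb, TensorProduct.add_tmul, TensorProduct.tmul_add]; abel
  · intro c a ha
    rw [map_smul, ha, smul_add, TensorProduct.smul_tmul', TensorProduct.tmul_smul]
  · intro a b ha hb
    simp only [map_sub, map_mul, ha, hb, mul_add, add_mul, Algebra.TensorProduct.tmul_mul_tmul,
      mul_one, one_mul, TensorProduct.sub_tmul, TensorProduct.tmul_sub]
    abel

theorem antipode_lieToAss : antipode K n (lieToAss K n f) = -lieToAss K n f := by
  refine lieToAss_induction (p := fun a => antipode K n a = -a) (antipode_gen K n) (by simp)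
    ?_ ?_ ?_ f
  · intro a b ha hb; rw [map_add, ha, hb, neg_add]
  · intro c a ha; rw [map_smul, ha, smul_neg]
  · intro a b ha hb
    rw [map_sub, antipode_mul, antipode_mul, ha, hb]; noncomm_ring

theorem coef_replicate_mul_comm (k : ℕ) (i : Fin n) (a b : Ass K n) :
    coef (List.replicate k i) (a * b) = coef (List.replicate k i) (b * a) := by
  have h : (LinearMap.mul K (Ass K n)).compr₂ (coef (List.replicate k i)) =
      (LinearMap.mul K (Ass K n)).flip.compr₂ (coef (List.replicate k i)) := by
    refine ext_words K n fun l => ext_words K n fun m => ?_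
    simp only [LinearMap.compr₂_apply, LinearMap.flip_apply, LinearMap.mul_apply', ← word_append,
      coef_word, List.append_eq_replicate_iff, add_comm m.length,
      and_comm (a := m = _)]
  exact LinearMap.congr_fun₂ h a b

theorem coef_replicate_lieToAss (i : Fin n) {k : ℕ} (hk : 2 ≤ k) :
    coef (List.replicate k i) (lieToAss K n f) = 0 := by
  refine lieToAss_induction (p := fun a => coef (List.replicate k i) a = 0) (fun j => ?_)
    (map_zero _) ?_ ?_ ?_ f
  · rw [← word_single, coef_word, if_neg fun h => ?_]
    have := congrArg List.length h
    simp only [List.length_singleton, List.length_replicate] at this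
    omega
  · intro a b ha hb; rw [map_add, ha, hb, add_zero]
  · intro c a ha; rw [map_smul, ha, smul_zero]
  · intro a b _ _; rw [map_sub, coef_replicate_mul_comm, sub_self]

end LieElements

section TangentialDerivations

variable (u : TDer K n)

theorem isDerivation_rho : IsDerivation (rho u) := rho_mul u

theorem rho_gen_eq_sub (i : Fin n) :
    rho u (gen K n i) = gen K n i * lieToAss K n (u i) - lieToAss K n (u i) * gen K n i := by
  rw [rho_gen, LieRing.of_associative_ring_bracket]

theorem rho_gen₀ : rho u (gen₀ K n) =
    ∑ i, gen K n i * lieToAss K n (u i) - ∑ i, lieToAss K n (u i) * gen K n i := by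
  simp [gen₀, rho_gen_eq_sub]

theorem counit_rho (a : Ass K n) : counit (rho u a) = 0 := by
  induction a using left_induction with
  | one => rw [(isDerivation_rho u).map_one, map_zero]
  | add a b ha hb => rw [map_add, map_add, ha, hb, add_zero]
  | smul c a ha => rw [map_smul, map_smul, ha, smul_zero]
  | gen_mul i a ih => simp [rho_mul, rho_gen_eq_sub, ih]

theorem coproduct_rho (a : Ass K n) :
    coproduct K n (rho u a) = tensorAct (rho u) (coproduct K n a) := by
  have rho_one := (isDerivation_rho u).map_one
  induction a using left_induction with
  | one => simp [rho_one, tensorAct, Algebra.TensorProduct.one_def]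
  | add a b ha hb => simp only [map_add, ha, hb]
  | smul c a ha => simp only [map_smul, ha]
  | gen_mul i a ih =>
    rw [rho_mul, map_add, map_mul, map_mul, map_mul, (isDerivation_rho u).tensorAct, ih]
    congr 2
    rw [rho_gen_eq_sub, map_sub, map_mul, map_mul, coproduct_lieToAss, coproduct_gen]
    simp only [tensorAct, map_add, LinearMap.add_apply, LinearMap.rTensor_tmul,
      LinearMap.lTensor_tmul, rho_one, rho_gen_eq_sub, mul_add, add_mul,
      Algebra.TensorProduct.tmul_mul_tmul, mul_one, one_mul, TensorProduct.sub_tmul,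
      TensorProduct.tmul_sub, TensorProduct.zero_tmul, TensorProduct.tmul_zero]
    abel

theorem antipode_rho (a : Ass K n) : antipode K n (rho u a) = rho u (antipode K n a) := by
  induction a using left_induction with
  | one => simp [(isDerivation_rho u).map_one, antipode_one]
  | add a b ha hb => simp only [map_add, ha, hb]
  | smul c a ha => simp only [map_smul, ha]
  | gen_mul i a ih =>
    have h : antipode K n (rho u (gen K n i)) = rho u (antipode K n (gen K n i)) := by
      rw [rho_gen_eq_sub, map_sub, antipode_mul, antipode_mul, antipode_lieToAss, antipode_gen,
        map_neg, rho_gen_eq_sub]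
      noncomm_ring
    rw [rho_mul, map_add, antipode_mul, antipode_mul, antipode_mul, rho_mul, ih, h]
    abel

/-- The action of `u` on `tr_n ⊗ ass_n`. -/
def mixedAct : Tr K n ⊗[K] Ass K n →ₗ[K] Tr K n ⊗[K] Ass K n :=
  LinearMap.rTensor (Ass K n) (rhoTr u) + LinearMap.lTensor (Tr K n) (rho u)

theorem closeUp_tensorAct (t : Ass K n ⊗[K] Ass K n) :
    closeUp K n (tensorAct (rho u) t) = mixedAct u (closeUp K n t) := by
  induction t with
  | zero => simp
  | add x y hx hy => simp only [map_add, hx, hy]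
  | tmul a b =>
    simp only [tensorAct, LinearMap.add_apply, LinearMap.rTensor_tmul, LinearMap.lTensor_tmul,
      map_add, closeUp_tmul, coproduct_rho]
    induction coproduct K n b with
    | zero => simp
    | add x y hx hy =>
      simp only [map_add] at hx hy ⊢
      rw [← hx, ← hy]; abel
    | tmul p q =>
      simp only [closeAux, mixedAct, LinearMap.add_apply, LinearMap.rTensor_tmul,
        LinearMap.lTensor_tmul, LinearMap.comp_apply, LinearMap.mulLeft_apply,
        map_add, antipode_rho, rhoTr_tr, rho_mul, TensorProduct.add_tmul]
      abel

theorem lTensor_tr_mixedAct (t : Tr K n ⊗[K] Ass K n) :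
    LinearMap.lTensor (Tr K n) (tr K n) (mixedAct u t) =
      tensorAct (rhoTr u) (LinearMap.lTensor (Tr K n) (tr K n) t) := by
  induction t with
  | zero => simp
  | add x y hx hy => simp only [map_add, hx, hy]
  | tmul p q => simp [mixedAct, tensorAct, rhoTr_tr]

theorem alt_tensorAct {V : Type*} [AddCommGroup V] [Module K V] (D : V →ₗ[K] V) (t : V ⊗[K] V) :
    alt K V (tensorAct D t) = tensorAct D (alt K V t) := by
  induction t with
  | zero => simp
  | add x y hx hy => simp only [map_add, hx, hy]
  | tmul p q => simp [alt, tensorAct]; abel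

end TangentialDerivations

section Defects

/-- The failure of `ρ(u)` to commute with `η_gr`. -/
def etaDefect (u : TDer K n) : Ass K n →ₗ[K] Ass K n →ₗ[K] Ass K n :=
  (etaBil K n).compr₂ (rho u) - etaBil K n ∘ₗ rho u - (etaBil K n).compl₂ (rho u)

/-- The failure of `ρ(u)` to commute with `μ^f_gr`. -/
def muDefect (u : TDer K n) : Ass K n →ₗ[K] Ass K n := rho u ∘ₗ muGr K n - muGr K n ∘ₗ rho u

variable (u : TDer K n)

theorem etaDefect_apply (a b : Ass K n) : etaDefect u a b =
    rho u (etaBil K n a b) - etaBil K n (rho u a) b - etaBil K n a (rho u b) := rfl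

theorem muDefect_apply (a : Ass K n) :
    muDefect u a = rho u (muGr K n a) - muGr K n (rho u a) := rfl

theorem etaDefect_eq_zero_iff :
    etaDefect u = 0 ↔ rho u ∘ₗ etaGr K n = etaGr K n ∘ₗ tensorAct (rho u) := by
  have h (a b : Ass K n) : (rho u ∘ₗ etaGr K n) (a ⊗ₜ b) -
      (etaGr K n ∘ₗ tensorAct (rho u)) (a ⊗ₜ b) = etaDefect u a b := by
    simp [etaDefect_apply, etaGr, tensorAct, sub_sub]
  constructor
  · intro hu
    refine TensorProduct.ext' fun a b => sub_eq_zero.1 ?_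
    rw [h, hu, LinearMap.zero_apply, LinearMap.zero_apply]
  · intro hu
    refine LinearMap.ext₂ fun a b => ?_
    rw [← h, hu, sub_self, LinearMap.zero_apply, LinearMap.zero_apply]

theorem muDefect_eq_zero_iff : muDefect u = 0 ↔ rho u ∘ₗ muGr K n = muGr K n ∘ₗ rho u :=
  sub_eq_zero

theorem isFoxPairing_etaDefect : IsFoxPairing (etaDefect u) where
  mul_left a b c := by
    simp only [etaDefect_apply, rho_mul, map_add, map_smul, LinearMap.add_apply,
      isFoxPairing_etaBil.mul_left, counit_rho, zero_smul, smul_sub, mul_sub]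
    abel
  mul_right a b c := by
    simp only [etaDefect_apply, rho_mul, map_add, map_smul,
      isFoxPairing_etaBil.mul_right, counit_rho, zero_smul, smul_sub, sub_mul]
    abel

theorem etaDefect_gen_gen (i j : Fin n) : etaDefect u (gen K n i) (gen K n j) =
    etaBil K n (gen K n i) (lieToAss K n (u j)) * gen K n j -
      gen K n i * etaBil K n (lieToAss K n (u i)) (gen K n j) := by
  rw [etaDefect_apply, rho_gen_eq_sub, rho_gen_eq_sub, map_sub, map_sub, LinearMap.sub_apply,
    isFoxPairing_etaBil.mul_left, isFoxPairing_etaBil.mul_left, isFoxPairing_etaBil.mul_right,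
    isFoxPairing_etaBil.mul_right, etaBil_gen_gen]
  simp only [counit_gen, counit_lieToAss, zero_smul, add_zero]
  split_ifs with h
  · rw [h, map_neg, rho_gen_eq_sub]; noncomm_ring
  · simp only [map_zero, mul_zero, zero_mul, zero_sub, sub_zero]; abel

theorem etaDefect_gen_gen_eq_etaBil_rho_gen₀ (i j : Fin n) :
    etaDefect u (gen K n i) (gen K n j) =
      etaBil K n (gen K n i) (etaBil K n (rho u (gen₀ K n)) (gen K n j)) := by
  have h : etaBil K n (rho u (gen₀ K n)) (gen K n j) =
      ∑ i, gen K n i * etaBil K n (lieToAss K n (u i)) (gen K n j) +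
        lieToAss K n (u j) * gen K n j := by
    rw [rho_gen₀, map_sub, LinearMap.sub_apply, etaBil_sum_gen, sub_neg_eq_add, map_sum,
      LinearMap.sum_apply]
    simp [isFoxPairing_etaBil.mul_left, counit_lieToAss]
  rw [etaDefect_gen_gen, h, map_add, etaBil_gen_sum, isFoxPairing_etaBil.mul_right,
    counit_lieToAss, zero_smul]
  abel

theorem mem_sder_iff : u ∈ sder K n ↔ etaDefect u = 0 := by
  constructor
  · intro hu
    have hu : rho u (gen₀ K n) = 0 := hu
    refine (isFoxPairing_etaDefect u).eq_zero fun i j => ?_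
    rw [etaDefect_gen_gen_eq_etaBil_rho_gen₀, hu, map_zero, LinearMap.zero_apply, map_zero]
  · intro hu
    have h (i j : Fin n) := etaDefect_gen_gen_eq_etaBil_rho_gen₀ u i j
    have hε := counit_rho u (gen₀ K n)
    change rho u (gen₀ K n) = 0
    generalize rho u (gen₀ K n) = c at h hε ⊢
    have h₀ : etaBil K n (gen₀ K n) (etaBil K n c (gen₀ K n)) = 0 := by
      simp [gen₀, LinearMap.sum_apply, ← h, hu]
    simpa [etaBil_gen₀_left, etaBil_gen₀_right, hε] using h₀

theorem isDerivation_muDefect {u : TDer K n} (hu : u ∈ sder K n) : IsDerivation (muDefect u) := by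
  intro a b
  have h := LinearMap.congr_fun₂ ((mem_sder_iff u).1 hu) a b
  rw [etaDefect_apply, LinearMap.zero_apply, LinearMap.zero_apply, sub_sub, sub_eq_zero] at h
  simp only [muDefect_apply, muGr_mul, rho_mul, map_add, h]
  noncomm_ring

/-- The map `a ↦ ∑ |a' ι(m(a'')')| ⊗ m(a'')''`, equal to `μ^f_{r,gr}` for `m = μ^f_gr`. -/
def closeDelta (m : Ass K n →ₗ[K] Ass K n) : Ass K n →ₗ[K] Tr K n ⊗[K] Ass K n :=
  closeUp K n ∘ₗ LinearMap.lTensor (Ass K n) m ∘ₗ (coproduct K n).toLinearMap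

theorem tensorAct_deltaGr_sub (a : Ass K n) :
    tensorAct (rhoTr u) (deltaGr K n (tr K n a)) - deltaGr K n (rhoTr u (tr K n a)) =
      alt K (Tr K n) (LinearMap.lTensor (Tr K n) (tr K n) (closeDelta (muDefect u) a)) := by
  rw [rhoTr_tr, deltaGr_tr, deltaGr_tr]
  simp only [deltaLift, murGr, closeDelta, LinearMap.comp_apply, AlgHom.toLinearMap_apply]
  rw [← alt_tensorAct, ← lTensor_tr_mixedAct, ← closeUp_tensorAct, coproduct_rho, ← map_sub,
    ← map_sub, ← map_sub]
  congr 3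
  induction coproduct K n a with
  | zero => simp
  | add x y hx hy =>
    simp only [map_add] at hx hy ⊢
    rw [← hx, ← hy]; abel
  | tmul p q => simp [tensorAct, muDefect]

end Defects

section CyclicCoefficients

theorem sum_rotate_succ {M : Type*} [AddCommMonoid M] (v : List (Fin n)) (f : List (Fin n) → M) :
    ∑ k ∈ Finset.range v.length, f (v.rotate (k + 1)) =
      ∑ k ∈ Finset.range v.length, f (v.rotate k) := by
  cases h : v.length with
  | zero => simp
  | succ m =>
    rw [Finset.sum_range_succ, Finset.sum_range_succ', ← h, List.rotate_length, List.rotate_zero]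

theorem sum_rotate_eq_comm {R : Type*} [AddCommMonoid R] (c : ℕ → R) (l v : List (Fin n)) :
    ∑ k ∈ Finset.range l.length, (if l.rotate k = v then c l.length else 0) =
      ∑ k ∈ Finset.range v.length, (if v.rotate k = l then c v.length else 0) := by
  by_cases hlen : l.length = v.length
  · rw [← sum_rotate_succ v fun w => if w = l then c v.length else 0, hlen,
      ← Finset.sum_range_reflect (fun k => if v.rotate (k + 1) = l then c v.length else 0)]
    refine Finset.sum_congr rfl fun k hk => if_congr ?_ rfl rfl
    have hk := Finset.mem_range.1 hk
    rw [show v.length - 1 - k + 1 = v.length - k by omega]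
    constructor
    · rintro rfl
      rw [List.rotate_rotate, List.length_rotate, Nat.add_sub_cancel' (by simpa using hk.le),
        List.rotate_length]
    · rintro rfl
      rw [List.rotate_rotate, Nat.sub_add_cancel hk.le, List.rotate_length]
  · have hne {l v : List (Fin n)} (h : l.length ≠ v.length) (k : ℕ) : l.rotate k ≠ v := by
      rintro rfl
      simp at h
    simp only [if_neg (hne hlen _), if_neg (hne (Ne.symm hlen) _), Finset.sum_const_zero]

theorem rotate_eq_replicate_iff (l : List (Fin n)) (k m : ℕ) (j : Fin n) :
    l.rotate k = List.replicate m j ↔ l = List.replicate m j := by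
  rw [List.rotate_eq_iff, List.rotate_replicate]

theorem tr_word_rotate (l : List (Fin n)) (k : ℕ) :
    tr K n (word K n (l.rotate k)) = tr K n (word K n l) := by
  rw [List.rotate_eq_drop_append_take_mod, word_append, tr_mul_comm, ← word_append,
    List.take_append_drop]

theorem coef_gen_mul_eq_coef_rotate (l : List (Fin n)) (i : Fin n) (a : Ass K n) :
    coef l (gen K n i * a) = coef (l.rotate 1) (a * gen K n i) := by
  cases l with
  | nil => simp [coef_nil]
  | cons j l =>
    rw [List.rotate_cons_succ, List.rotate_zero, coef_cons_gen_mul, coef_concat_mul_gen]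

theorem sum_coef_rotate_mul_comm (v : List (Fin n)) (a b : Ass K n) :
    ∑ k ∈ Finset.range v.length, coef (v.rotate k) (a * b) =
      ∑ k ∈ Finset.range v.length, coef (v.rotate k) (b * a) := by
  induction a using left_induction generalizing b with
  | one => rw [one_mul, mul_one]
  | add a c ha hc => simp only [add_mul, mul_add, map_add, Finset.sum_add_distrib, ha, hc]
  | smul r a ha => simp only [smul_mul_assoc, mul_smul_comm, map_smul, ← Finset.smul_sum, ha]
  | gen_mul i a ih =>
    rw [mul_assoc, ← mul_assoc b, ← ih, ← mul_assoc a b,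
      ← sum_rotate_succ v fun l => coef l (a * b * gen K n i)]
    simp only [coef_gen_mul_eq_coef_rotate, List.rotate_rotate]

/-- The functional on `tr_n` that sums the coefficients of all rotations of the word `v`. -/
def cyclicCoef (v : List (Fin n)) : Tr K n →ₗ[K] K :=
  (commutators K n).liftQ (∑ k ∈ Finset.range v.length, coef (v.rotate k)) <|
    Submodule.span_le.2 <| by
      rintro _ ⟨a, b, rfl⟩
      simp [sum_coef_rotate_mul_comm v a b]

theorem cyclicCoef_tr (v : List (Fin n)) (a : Ass K n) :
    cyclicCoef v (tr K n a) = ∑ k ∈ Finset.range v.length, coef (v.rotate k) a :=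
  LinearMap.sum_apply _ _ _

/-- The functional on `tr_n` induced by the counit. -/
def trCounit : Tr K n →ₗ[K] K :=
  (commutators K n).liftQ counit.toLinearMap <| Submodule.span_le.2 <| by
    rintro _ ⟨a, b, rfl⟩
    simp [mul_comm]

theorem trCounit_tr (a : Ass K n) : trCounit (tr K n a) = counit a := rfl

/-- The average over the rotations of each word. -/
def cyclicAverage : Ass K n →ₗ[K] Ass K n :=
  onWords K n fun l => (l.length : K)⁻¹ • ∑ k ∈ Finset.range l.length, word K n (l.rotate k)

theorem coef_cyclicAverage (v : List (Fin n)) (a : Ass K n) :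
    coef v (cyclicAverage a) = (v.length : K)⁻¹ * cyclicCoef v (tr K n a) := by
  have h : coef v ∘ₗ cyclicAverage = (v.length : K)⁻¹ • (cyclicCoef v ∘ₗ tr K n) := by
    refine ext_words K n fun l => ?_
    simp only [LinearMap.comp_apply, LinearMap.smul_apply, cyclicCoef_tr, cyclicAverage,
      onWords_word, map_smul, map_sum, coef_word, smul_eq_mul, Finset.mul_sum, mul_ite, mul_one,
      mul_zero]
    rw [sum_rotate_eq_comm fun m => (m : K)⁻¹]
    simp only [eq_comm]
  exact LinearMap.congr_fun h a

theorem cyclicCoef_eq_zero_of_mem_span {p : ℕ → Prop} {t : Tr K n}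
    (ht : t ∈ Submodule.span K {t | ∃ l : List (Fin n), p l.length ∧ t = tr K n (word K n l)})
    {v : List (Fin n)} (hv : ¬p v.length) : cyclicCoef v t = 0 := by
  refine (Submodule.span_le (p := LinearMap.ker (cyclicCoef v))).2 ?_ ht
  rintro _ ⟨l, hl, rfl⟩
  refine (cyclicCoef_tr v _).trans (Finset.sum_eq_zero fun k _ => ?_)
  rw [coef_word, if_neg]
  rintro rfl
  simp [hv] at hl

variable [CharZero K]

theorem tr_cyclicAverage (a : Ass K n) :
    tr K n (cyclicAverage a) = tr K n a - counit a • tr K n 1 := by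
  have h : tr K n ∘ₗ cyclicAverage =
      tr K n - (counit (K := K) (n := n)).toLinearMap.smulRight (tr K n 1) := by
    refine ext_words K n fun l => ?_
    simp only [LinearMap.comp_apply, LinearMap.sub_apply, LinearMap.smulRight_apply,
      cyclicAverage, onWords_word, map_smul, map_sum, tr_word_rotate, Finset.sum_const,
      Finset.card_range, AlgHom.toLinearMap_apply]
    cases l with
    | nil => simp [word_nil]
    | cons i l =>
      rw [← Nat.cast_smul_eq_nsmul K, smul_smul, inv_mul_cancel₀ (by simp; norm_cast)]
      simp [word_cons]
  exact LinearMap.congr_fun h a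

theorem mem_span_of_cyclicCoef_eq_zero {p : ℕ → Prop} {t : Tr K n} (ht : trCounit t = 0)
    (h : ∀ v : List (Fin n), ¬p v.length → cyclicCoef v t = 0) :
    t ∈ Submodule.span K {t | ∃ l : List (Fin n), p l.length ∧ t = tr K n (word K n l)} := by
  obtain ⟨a, rfl⟩ : ∃ a, tr K n a = t := (commutators K n).mkQ_surjective t
  have ha := tr_cyclicAverage a
  rw [← trCounit_tr, ht, zero_smul, sub_zero] at ha
  rw [← ha]
  refine map_mem_of_coef _ _ _ fun l hl => Submodule.subset_span ⟨l, ?_, rfl⟩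
  by_contra hp
  exact hl (by rw [coef_cyclicAverage, h l hp, mul_zero])

end CyclicCoefficients

section Residues

/-- The residues `r_i = ∂_i u_i - μ^f_gr(u_i)`, which govern both the divergence of a special
derivation `u` and its commutator with `μ^f_gr`. -/
def muResidue (u : TDer K n) (i : Fin n) : Ass K n :=
  partialD K n i (lieToAss K n (u i)) - muGr K n (lieToAss K n (u i))

/-- The element `∑_i x_i u_i`, whose cyclic derivatives are the components of a special
derivation `u`. -/
def potential (u : TDer K n) : Ass K n := ∑ i, gen K n i * lieToAss K n (u i)

variable {u : TDer K n}

theorem trCounit_divergence : trCounit (divergence u) = 0 := by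
  simp [divergence, trCounit_tr]

theorem coef_cons_potential (i : Fin n) (l : List (Fin n)) :
    coef (i :: l) (potential u) = coef l (lieToAss K n (u i)) :=
  coef_cons_sum _ i l

theorem coef_replicate_muResidue (i : Fin n) {m : ℕ} (hm : m ≠ 0) :
    coef (List.replicate m i) (muResidue u i) = 0 := by
  have h : coef (List.replicate (m + 1) i) (lieToAss K n (u i)) = 0 :=
    coef_replicate_lieToAss _ i (by omega)
  rw [muResidue, map_sub, coef_partialD, ← List.replicate_succ', h, coef_muGr,
    Finset.sum_eq_zero, neg_zero, sub_zero]
  intro k hk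
  rw [List.length_replicate, Finset.mem_range] at hk
  rwa [List.take_replicate, List.drop_replicate, List.replicate_append_replicate,
    show min (k + 1) m + (m - k) = m + 1 by omega]

variable (hu : u ∈ sder K n)
include hu

theorem coef_rotate_potential (l : List (Fin n)) (k : ℕ) :
    coef (l.rotate k) (potential u) = coef l (potential u) := by
  have hsum : potential u = ∑ i, lieToAss K n (u i) * gen K n i :=
    sub_eq_zero.1 ((rho_gen₀ u).symm.trans hu)
  induction k with
  | zero => simp
  | succ k ih =>
    rw [← List.rotate_rotate, ← ih]
    cases l.rotate k with
    | nil => simp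
    | cons i l =>
      rw [List.rotate_cons_succ, List.rotate_zero, coef_cons_potential, hsum, coef_concat_sum]

theorem cyclicCoef_divergence (i : Fin n) (w : List (Fin n)) :
    cyclicCoef (i :: w) (divergence u) = coef w (muResidue u i) := by
  have hdiv : divergence u =
      tr K n (∑ i, gen K n i * partialD K n i (lieToAss K n (u i))) := by
    rw [map_sum, divergence]
  rw [hdiv, cyclicCoef_tr, List.length_cons, Finset.sum_range_succ', List.rotate_zero,
    coef_cons_sum, muResidue, map_sub, coef_muGr, sub_neg_eq_add, add_comm]
  congr 1
  refine Finset.sum_congr rfl fun k hk => ?_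
  have hk : k < w.length := Finset.mem_range.1 hk
  have hdrop : w.drop k = w[k] :: w.drop (k + 1) := (List.getElem_cons_drop hk).symm
  have htake : w.take (k + 1) = w.take k ++ [w[k]] := (List.take_concat_get' w k hk).symm
  have hrot : (i :: w).rotate (k + 1) = w[k] :: (w.drop (k + 1) ++ i :: w.take k) := by
    rw [List.rotate_cons_succ, List.rotate_eq_drop_append_take (by simp; omega),
      List.drop_append_of_le_length hk.le, List.take_append_of_le_length hk.le, hdrop]
    simp only [List.cons_append, List.append_assoc, List.nil_append]
  have hcyc : w[k] :: (w.drop (k + 1) ++ i :: w.take k ++ [w[k]]) =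
      (i :: w.take (k + 1) ++ w.drop k).rotate (i :: w.take (k + 1)).length := by
    rw [List.rotate_append_length_eq, hdrop, htake]
    simp only [List.cons_append, List.append_assoc]
  rw [hrot, coef_cons_sum, coef_partialD, ← coef_cons_potential, hcyc, coef_rotate_potential hu,
    List.cons_append, coef_cons_potential]

theorem muDefect_gen (i : Fin n) :
    muDefect u (gen K n i) = gen K n i * muResidue u i - muResidue u i * gen K n i := by
  have heta : etaBil K n (gen K n i) (lieToAss K n (u i)) =
      -(gen K n i * partialD K n i (lieToAss K n (u i))) := by
    have h := etaDefect_gen_gen u i i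
    rw [(mem_sder_iff u).1 hu, LinearMap.zero_apply, LinearMap.zero_apply, eq_comm, sub_eq_zero,
      etaBil_gen_right, mul_neg, ← mul_assoc, ← neg_mul] at h
    exact mul_right_cancel₀ (FreeAlgebra.ι_ne_zero i) h
  rw [muDefect_apply, muGr_gen, map_zero, rho_gen_eq_sub, map_sub, muGr_mul, muGr_mul, muGr_gen,
    heta, etaBil_gen_right, muResidue]
  noncomm_ring

theorem muDefect_eq_zero_iff_coef_muResidue :
    muDefect u = 0 ↔ ∀ (i : Fin n) (w : List (Fin n)), w ≠ [] → coef w (muResidue u i) = 0 := by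
  have hcommute : muDefect u = 0 ↔ ∀ i, Commute (gen K n i) (muResidue u i) := by
    constructor
    · intro h i
      have hi := muDefect_gen hu i
      rw [h, LinearMap.zero_apply] at hi
      exact sub_eq_zero.1 hi.symm
    · intro h
      refine (isDerivation_muDefect hu).ext_gen (fun a b => by simp) fun i => ?_
      rw [muDefect_gen hu, (h i).eq, sub_self, LinearMap.zero_apply]
  rw [hcommute]
  refine forall_congr' fun i => (commute_gen_iff i _).trans ⟨fun h w hw => ?_, fun h w hw => ?_⟩
  · by_cases hrep : w = List.replicate w.length i
    · rw [hrep]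
      exact coef_replicate_muResidue i (by simpa using hw)
    · exact h w hrep
  · exact h w (by rintro rfl; exact hw rfl)

end Residues

section CloseUp

theorem closeUp_coproduct_mul (a : Ass K n) (t : Ass K n ⊗[K] Ass K n) :
    closeUp K n (coproduct K n a * t) =
      LinearMap.lTensor (Tr K n) (LinearMap.mulLeft K a) (closeUp K n t) := by
  induction a using left_induction generalizing t with
  | one => simp
  | add x y hx hy =>
    rw [map_add, add_mul, map_add, hx, hy, ← LinearMap.add_apply, ← LinearMap.lTensor_add]
    congr 2
    ext z; simp [add_mul]
  | smul r x hx =>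
    rw [map_smul, smul_mul_assoc, map_smul, hx, ← LinearMap.smul_apply, ← LinearMap.lTensor_smul]
    congr 2
    ext z; simp
  | gen_mul i a ih =>
    rw [map_mul (coproduct K n), coproduct_gen, mul_assoc, add_mul, map_add, closeUp_left,
      add_neg_cancel_left, ih,
      lmul, ← LinearMap.comp_apply, ← LinearMap.lTensor_comp]
    congr 2
    ext z; simp

theorem closeUp_mul_coproduct (a : Ass K n) (t : Ass K n ⊗[K] Ass K n) :
    closeUp K n (t * coproduct K n a) =
      LinearMap.lTensor (Tr K n) (LinearMap.mulRight K a) (closeUp K n t) := by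
  induction a using right_induction generalizing t with
  | one => simp
  | add x y hx hy =>
    rw [map_add, mul_add, map_add, hx, hy, ← LinearMap.add_apply, ← LinearMap.lTensor_add]
    congr 2
    ext z; simp [mul_add]
  | smul r x hx =>
    rw [map_smul, mul_smul_comm, map_smul, hx, ← LinearMap.smul_apply, ← LinearMap.lTensor_smul]
    congr 2
    ext z; simp
  | mul_gen a i ih =>
    rw [map_mul (coproduct K n), coproduct_gen, ← mul_assoc, mul_add, map_add, closeUp_right,
      add_neg_cancel_left, ih, rmul, ← LinearMap.comp_apply, ← LinearMap.lTensor_comp]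
    congr 2
    ext z; simp [mul_assoc]

theorem closeDelta_mul {d : Ass K n →ₗ[K] Ass K n} (hd : IsDerivation d) (a b : Ass K n) :
    closeDelta d (a * b) = LinearMap.lTensor (Tr K n) (LinearMap.mulRight K b) (closeDelta d a) +
      LinearMap.lTensor (Tr K n) (LinearMap.mulLeft K a) (closeDelta d b) := by
  simp only [closeDelta, LinearMap.comp_apply, AlgHom.toLinearMap_apply, map_mul, hd.lTensor _ _,
    map_add, closeUp_mul_coproduct, closeUp_coproduct_mul]

theorem lTensor_tr_closeDelta_inner (b a : Ass K n) :
    LinearMap.lTensor (Tr K n) (tr K n) (closeDelta (innerDerivation b) a) = 0 := by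
  have h (t : Ass K n ⊗[K] Ass K n) :
      LinearMap.lTensor (Ass K n) (innerDerivation b) t = t * (1 ⊗ₜ b) - (1 ⊗ₜ b) * t := by
    induction t with
    | zero => simp
    | add x y hx hy => rw [map_add, hx, hy, add_mul, mul_add]; abel
    | tmul p q => simp [innerDerivation_apply, TensorProduct.tmul_sub]
  simp only [closeDelta, LinearMap.comp_apply, AlgHom.toLinearMap_apply, h, map_sub,
    closeUp_coproduct_mul, closeUp_mul_coproduct]
  rw [sub_eq_zero]
  induction closeUp K n (1 ⊗ₜ b) with
  | zero => simp
  | add x y hx hy => simp only [map_add, hx, hy]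
  | tmul p q => simp [tr_mul_comm K n a]

end CloseUp

section Counits

theorem lid_rTensor_counit_coproduct (a : Ass K n) :
    TensorProduct.lid K (Ass K n)
      (LinearMap.rTensor (Ass K n) counit.toLinearMap (coproduct K n a)) = a := by
  have h : (Algebra.TensorProduct.lid K (Ass K n)).toAlgHom.comp
      ((Algebra.TensorProduct.map counit (AlgHom.id K (Ass K n))).comp (coproduct K n)) =
        AlgHom.id K (Ass K n) := by
    ext i
    simp [coproduct_gen]
  exact DFunLike.congr_fun h a

theorem counit_antipode (a : Ass K n) : counit (antipode K n a) = counit a := by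
  induction a using left_induction with
  | one => rw [antipode_one]
  | add x y hx hy => simp only [map_add, hx, hy]
  | smul r x hx => simp only [map_smul, hx]
  | gen_mul i a => simp [antipode_mul, antipode_gen]

/-- The map `p ⊗ q ↦ ε(p) q`. -/
def counitLeft (V : Type*) [AddCommGroup V] [Module K V] : Tr K n ⊗[K] V →ₗ[K] V :=
  (TensorProduct.lid K V).toLinearMap ∘ₗ LinearMap.rTensor V trCounit

/-- The map `p ⊗ q ↦ ε(q) p`. -/
def counitRight : Tr K n ⊗[K] Ass K n →ₗ[K] Tr K n :=
  (TensorProduct.rid K (Tr K n)).toLinearMap ∘ₗ LinearMap.lTensor (Tr K n) counit.toLinearMap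

@[simp]
theorem counitLeft_tmul {V : Type*} [AddCommGroup V] [Module K V] (p : Tr K n) (q : V) :
    counitLeft V (p ⊗ₜ q) = trCounit p • q := by
  simp [counitLeft]

@[simp]
theorem counitRight_tmul (p : Tr K n) (q : Ass K n) : counitRight (p ⊗ₜ q) = counit q • p := by
  simp [counitRight]

theorem counitLeft_closeUp (p q : Ass K n) :
    counitLeft (Ass K n) (closeUp K n (p ⊗ₜ q)) = counit p • q := by
  conv_rhs => rw [← lid_rTensor_counit_coproduct q]
  rw [closeUp_tmul]
  induction coproduct K n q with
  | zero => simp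
  | add x y hx hy => simp only [map_add, hx, hy, smul_add]
  | tmul x y => simp [closeAux, trCounit_tr, counit_antipode, smul_smul]

theorem counitLeft_closeDelta (m : Ass K n →ₗ[K] Ass K n) (a : Ass K n) :
    counitLeft (Ass K n) (closeDelta m a) = m a := by
  conv_rhs => rw [← lid_rTensor_counit_coproduct a]
  simp only [closeDelta, LinearMap.comp_apply, AlgHom.toLinearMap_apply]
  induction coproduct K n a with
  | zero => simp
  | add x y hx hy => simp only [map_add, hx, hy]
  | tmul x y => simp [counitLeft_closeUp]

theorem counitLeft_alt (t : Tr K n ⊗[K] Ass K n) :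
    counitLeft (Tr K n) (alt K (Tr K n) (LinearMap.lTensor (Tr K n) (tr K n) t)) =
      tr K n (counitLeft (Ass K n) t) - counitRight t := by
  induction t with
  | zero => simp
  | add x y hx hy => simp only [map_add, hx, hy]; abel
  | tmul p q => simp [alt, trCounit_tr]

theorem counitRight_lTensor_mulLeft (a : Ass K n) (t : Tr K n ⊗[K] Ass K n) :
    counitRight (LinearMap.lTensor (Tr K n) (LinearMap.mulLeft K a) t) =
      counit a • counitRight t := by
  induction t with
  | zero => simp
  | add x y hx hy => simp only [map_add, hx, hy, smul_add]
  | tmul p q => simp [smul_smul]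

theorem counitRight_lTensor_mulRight (a : Ass K n) (t : Tr K n ⊗[K] Ass K n) :
    counitRight (LinearMap.lTensor (Tr K n) (LinearMap.mulRight K a) t) =
      counit a • counitRight t := by
  induction t with
  | zero => simp
  | add x y hx hy => simp only [map_add, hx, hy, smul_add]
  | tmul p q => simp [smul_smul, mul_comm]

theorem counitRight_closeUp_commutator (i : Fin n) (q : Ass K n) :
    counitRight (closeUp K n (1 ⊗ₜ (gen K n i * q - q * gen K n i))) = 0 := by
  have hl := closeUp_left K n i (1 ⊗ₜ q)
  have hr := closeUp_right K n i (1 ⊗ₜ q)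
  simp only [Algebra.TensorProduct.tmul_mul_tmul, one_mul, mul_one] at hl hr
  rw [TensorProduct.tmul_sub, map_sub, hl, hr, map_sub, map_add, map_add, lmul, rmul,
    counitRight_lTensor_mulLeft, counitRight_lTensor_mulRight, sub_self]

theorem counitRight_closeDelta {d : Ass K n →ₗ[K] Ass K n} (hd : IsDerivation d)
    {r : Fin n → Ass K n} (hr : ∀ i, d (gen K n i) = gen K n i * r i - r i * gen K n i)
    (a : Ass K n) : counitRight (closeDelta d a) = 0 := by
  induction a using left_induction with
  | one => simp [closeDelta, Algebra.TensorProduct.one_def, hd.map_one]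
  | add x y hx hy => rw [map_add, map_add, hx, hy, add_zero]
  | smul c x hx => rw [map_smul, map_smul, hx, smul_zero]
  | gen_mul i a ih =>
    have hgen : counitRight (closeDelta d (gen K n i)) = 0 := by
      rw [closeDelta, LinearMap.comp_apply, LinearMap.comp_apply, AlgHom.toLinearMap_apply,
        coproduct_gen, map_add, LinearMap.lTensor_tmul, LinearMap.lTensor_tmul, hd.map_one,
        TensorProduct.tmul_zero, zero_add, hr, counitRight_closeUp_commutator]
    rw [closeDelta_mul hd, map_add, counitRight_lTensor_mulLeft, counitRight_lTensor_mulRight,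
      hgen, ih, smul_zero, smul_zero, add_zero]

end Counits

section Cobracket

variable {u : TDer K n}

theorem tensorAct_deltaGr_of_muDefect_eq_inner {b : Ass K n}
    (h : muDefect u = innerDerivation b) :
    tensorAct (rhoTr u) ∘ₗ deltaGr K n = deltaGr K n ∘ₗ rhoTr u := by
  refine LinearMap.ext fun t => sub_eq_zero.1 ?_
  obtain ⟨a, rfl⟩ : ∃ a, tr K n a = t := (commutators K n).mkQ_surjective t
  rw [LinearMap.comp_apply, LinearMap.comp_apply, tensorAct_deltaGr_sub, h,
    lTensor_tr_closeDelta_inner, map_zero]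

variable (hu : u ∈ sder K n)
include hu

theorem exists_muDefect_eq_inner {β : ℕ → K} (h : ∀ (i : Fin n) (w : List (Fin n)),
    w ≠ List.replicate w.length i → coef w (muResidue u i) = β w.length) :
    ∃ b : Ass K n, muDefect u = innerDerivation b := by
  choose d hd using fun i => exists_coef_eq_zero_of_le_length (muResidue u i)
  let b : Ass K n := ∑ m ∈ Finset.range (∑ i, d i), β m • gen₀ K n ^ m
  have hb (l : List (Fin n)) : coef l b = if l.length < ∑ i, d i then β l.length else 0 := by
    simp [b, coef_gen₀_pow]
  refine ⟨b, (isDerivation_muDefect hu).ext_gen (isDerivation_innerDerivation b) fun i => ?_⟩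
  have hcomm : Commute (gen K n i) (muResidue u i - b) := by
    refine (commute_gen_iff i _).2 fun l hl => ?_
    rw [map_sub, hb]
    split_ifs with hlt
    · rw [h i l hl, sub_self]
    · have hdi : d i ≤ ∑ i, d i :=
        Finset.single_le_sum (fun _ _ => Nat.zero_le _) (Finset.mem_univ i)
      rw [hd i l (hdi.trans (not_lt.1 hlt)), sub_zero]
  have hcomm : gen K n i * (muResidue u i - b) = (muResidue u i - b) * gen K n i := hcomm
  rw [mul_sub, sub_mul, sub_eq_sub_iff_sub_eq_sub] at hcomm
  rw [muDefect_gen hu, innerDerivation_apply, hcomm]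

theorem tr_muDefect_eq_zero
    (h : tensorAct (rhoTr u) ∘ₗ deltaGr K n = deltaGr K n ∘ₗ rhoTr u) (a : Ass K n) :
    tr K n (muDefect u a) = 0 := by
  have hδ := tensorAct_deltaGr_sub u a
  rw [← LinearMap.comp_apply, h, LinearMap.comp_apply, sub_self] at hδ
  have halt := counitLeft_alt (closeDelta (muDefect u) a)
  rw [← hδ, map_zero, counitLeft_closeDelta,
    counitRight_closeDelta (isDerivation_muDefect hu) (muDefect_gen hu), sub_zero] at halt
  exact halt.symm

end Cobracket

section KashiwaraVergne

theorem coef_aeval_gen₀ (p : Polynomial K) (l : List (Fin n)) :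
    coef l (Polynomial.aeval (gen₀ K n) p) = p.coeff l.length := by
  induction p using Polynomial.induction_on' with
  | add p q hp hq => simp [hp, hq]
  | monomial m c =>
    rw [Polynomial.aeval_monomial, ← Algebra.smul_def, map_smul, coef_gen₀_pow,
      Polynomial.coeff_monomial]
    simp [eq_comm]

theorem coef_aeval_gen (p : Polynomial K) (i : Fin n) (l : List (Fin n)) :
    coef l (Polynomial.aeval (gen K n i) p) =
      if l = List.replicate l.length i then p.coeff l.length else 0 := by
  induction p using Polynomial.induction_on' with
  | add p q hp hq => rw [map_add, map_add, hp, hq]; split_ifs <;> simp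
  | monomial m c =>
    rw [Polynomial.aeval_monomial, ← Algebra.smul_def, map_smul, coef_gen_pow,
      Polynomial.coeff_monomial]
    by_cases hm : m = l.length
    · subst hm; simp
    · rw [if_neg, if_neg hm, smul_zero, ite_self]
      rintro rfl
      simp at hm

theorem cyclicCoef_aeval (f₀ : Polynomial K) (f : Fin n → Polynomial K) (i : Fin n)
    (w : List (Fin n)) :
    cyclicCoef (i :: w) (tr K n (Polynomial.aeval (gen₀ K n) f₀) +
      ∑ j, tr K n (Polynomial.aeval (gen K n j) (f j))) =
      (w.length + 1 : K) * (f₀.coeff (w.length + 1) +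
        if w = List.replicate w.length i then (f i).coeff (w.length + 1) else 0) := by
  have hcons (j : Fin n) : i :: w = List.replicate (w.length + 1) j ↔
      j = i ∧ w = List.replicate w.length i := by
    rw [List.replicate_succ, List.cons.injEq]
    constructor <;> rintro ⟨rfl, h⟩ <;> exact ⟨rfl, h⟩
  rw [map_add, map_sum, mul_add]
  simp only [cyclicCoef_tr, coef_aeval_gen₀, coef_aeval_gen, rotate_eq_replicate_iff,
    List.length_rotate, List.length_cons, hcons, Finset.sum_const, Finset.card_range,
    nsmul_eq_mul, ite_and, Finset.sum_ite_eq', Finset.mem_univ, mul_ite, mul_zero, if_true,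
    Nat.cast_add, Nat.cast_one]

theorem cyclicCoef_nil (t : Tr K n) : cyclicCoef [] t = 0 := by
  obtain ⟨a, rfl⟩ : ∃ a, tr K n a = t := (commutators K n).mkQ_surjective t
  simp [cyclicCoef_tr]

theorem span_range_tr_gen : Submodule.span K (Set.range fun i => tr K n (gen K n i)) =
    Submodule.span K
      {t | ∃ l : List (Fin n), l.length = 1 ∧ t = tr K n (word K n l)} := by
  congr 1
  ext t
  simp only [Set.mem_range, Set.mem_ofPred_eq, List.length_eq_one_iff]
  constructor
  · rintro ⟨i, rfl⟩
    exact ⟨[i], ⟨i, rfl⟩, by rw [word_single]⟩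
  · rintro ⟨_, ⟨i, rfl⟩, rfl⟩
    exact ⟨i, by rw [word_single]⟩

theorem coef_muResidue_of_mem_krv {u : TDer K n} (hu : u ∈ krv K n) :
    ∃ β : ℕ → K, ∀ (i : Fin n) (w : List (Fin n)),
      w ≠ List.replicate w.length i → coef w (muResidue u i) = β w.length := by
  obtain ⟨hu, f₀, f, h⟩ := hu
  refine ⟨fun m => (m + 1 : K) * PowerSeries.coeff (m + 1) f₀, fun i w hw => ?_⟩
  have hw₀ := cyclicCoef_eq_zero_of_mem_span (p := (w.length + 2 ≤ ·)) (v := i :: w)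
    (h (w.length + 2)) (by simp)
  rwa [map_sub, cyclicCoef_divergence hu, cyclicCoef_aeval, if_neg hw, add_zero, sub_eq_zero,
    PowerSeries.coeff_trunc, if_pos (by omega)] at hw₀

variable [CharZero K] {u : TDer K n}

theorem mem_krv₀_iff_coef_muResidue : u ∈ krv₀ K n ↔ u ∈ sder K n ∧
    ∀ (i : Fin n) (w : List (Fin n)), w ≠ [] → coef w (muResidue u i) = 0 := by
  rw [krv₀, Set.mem_ofPred_eq, span_range_tr_gen]
  refine and_congr_right fun hu => ⟨fun h i w hw => ?_, fun h => ?_⟩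
  · rw [← cyclicCoef_divergence hu]
    exact cyclicCoef_eq_zero_of_mem_span (p := (· = 1)) h (by simpa using hw)
  · refine mem_span_of_cyclicCoef_eq_zero (p := (· = 1)) trCounit_divergence fun v hv => ?_
    cases v with
    | nil => exact cyclicCoef_nil _
    | cons i w =>
      rw [cyclicCoef_divergence hu]
      exact h i w (by simpa using hv)

-- As `cyclicCoef (i :: w)` sums over `w.length + 1` rotations, `f_0` must satisfy
-- `s f_0'(s) = ∑ β_m s^(m+1)`; the series `f_i` then corrects the words `x_i^m`.
theorem mem_krv_of_coef_muResidue (hu : u ∈ sder K n) {β : ℕ → K}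
    (h : ∀ (i : Fin n) (w : List (Fin n)),
      w ≠ List.replicate w.length i → coef w (muResidue u i) = β w.length) : u ∈ krv K n := by
  refine ⟨hu, PowerSeries.mk fun k => β (k - 1) / k, fun i => PowerSeries.mk fun k =>
    (coef (List.replicate (k - 1) i) (muResidue u i) - β (k - 1)) / k, fun N => ?_⟩
  refine mem_span_of_cyclicCoef_eq_zero (p := (N ≤ ·)) ?_ fun v hv => ?_
  · simp [trCounit_divergence, trCounit_tr, ← coef_nil, coef_aeval_gen₀, coef_aeval_gen,
      PowerSeries.coeff_trunc]
  cases v with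
  | nil => exact cyclicCoef_nil _
  | cons i w =>
    have hN : w.length + 1 < N := by simpa using hv
    have h0 : (w.length + 1 : K) ≠ 0 := by norm_cast
    rw [map_sub, cyclicCoef_divergence hu, cyclicCoef_aeval, PowerSeries.coeff_trunc, if_pos hN,
      PowerSeries.coeff_trunc, if_pos hN, PowerSeries.coeff_mk, PowerSeries.coeff_mk,
      Nat.add_sub_cancel, Nat.cast_add, Nat.cast_one]
    by_cases hw : w = List.replicate w.length i
    · rw [if_pos hw, ← hw]
      field_simp
      ring
    · rw [if_neg hw, h i w hw]
      field_simp
      ring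

end KashiwaraVergne

section Necessity

section WordCombinatorics

variable {α : Type*}

theorem eq_zero_of_replicate_isPrefix_rotate {i : α} {w : List α} (hw : w ≠ [])
    (hhead : w.head hw ≠ i) (hlast : w.getLast hw ≠ i) {k : ℕ} (hk : k < w.length + w.length)
    (h : List.replicate w.length i <+: (List.replicate w.length i ++ w).rotate k) : k = 0 := by
  have hpos : 0 < w.length := List.length_pos_of_ne_nil hw
  have hblock (p : ℕ) (hp : p < w.length) :
      (List.replicate w.length i ++ w)[(p + k) % (w.length + w.length)]? = some i := by
    obtain ⟨t, ht⟩ := h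
    have hrot := List.getElem?_rotate (l := List.replicate w.length i ++ w) (n := k) (m := p)
      (by simp; omega)
    rw [List.length_append, List.length_replicate] at hrot
    rw [← hrot, ← ht, List.getElem?_append_left (by simpa using hp), List.getElem?_replicate,
      if_pos hp]
  have hright {q : ℕ} (hq : w.length ≤ q) :
      (List.replicate w.length i ++ w)[q]? = w[q - w.length]? := by
    rw [List.getElem?_append_right (by simpa using hq), List.length_replicate]
  by_contra hk₀
  rcases le_or_gt k w.length with hle | hlt
  · have hfirst := hblock (w.length - k) (by omega)
    rw [Nat.sub_add_cancel hle, Nat.mod_eq_of_lt (by omega), hright le_rfl,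
      Nat.sub_self, ← List.head?_eq_getElem?, List.head?_eq_some_head hw] at hfirst
    exact hhead (Option.some.inj hfirst)
  · have hfinal := hblock (w.length + w.length - 1 - k) (by omega)
    rw [Nat.sub_add_cancel (by omega), Nat.mod_eq_of_lt (by omega),
      hright (by omega), Nat.sub_right_comm, Nat.add_sub_cancel, ← List.getLast?_eq_getElem?,
      List.getLast?_eq_some_getLast hw] at hfinal
    exact hlast (Option.some.inj hfinal)

theorem eq_of_length_eq_of_cons_eq_concat {β : Type*} {b : List α → β}
    (hb : ∀ i j w, b (i :: w) = b (w ++ [j])) {l m : List α} (h : l.length = m.length) :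
    b l = b m := by
  suffices hshift : ∀ s, b (l ++ s) = b (s ++ m) by simpa using hshift []
  induction l generalizing m with
  | nil => simp [List.length_eq_zero_iff.1 h.symm]
  | cons i l ih =>
    cases m with
    | nil => simp at h
    | cons j m =>
      intro s
      rw [List.cons_append, hb i j, List.append_assoc, ih (Nat.succ.inj h), List.append_assoc,
        List.singleton_append]

theorem exists_eq_length_function {R : Type*} [Nonempty R] {f : α → List α → R}
    (hagree : ∀ i j w, w ≠ List.replicate w.length i → w ≠ List.replicate w.length j →
      f i w = f j w)
    (hcyc : ∀ i j w, f i (j :: w) = f j (w ++ [i])) :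
    ∃ β : ℕ → R, ∀ i w, w ≠ List.replicate w.length i → f i w = β w.length := by
  have hcommon (w : List α) : ∃ c, ∀ i, w ≠ List.replicate w.length i → f i w = c := by
    by_cases h : ∃ j, w ≠ List.replicate w.length j
    · obtain ⟨j, hj⟩ := h
      exact ⟨f j w, fun i hi => hagree i j w hi hj⟩
    · exact ⟨Classical.arbitrary R, fun i hi => absurd ⟨i, hi⟩ h⟩
  choose b hb using hcommon
  have hshift (i j : α) (w : List α) : b (i :: w) = b (w ++ [j]) := by
    by_cases hconst : i = j ∧ ∀ x ∈ w, x = j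
    · obtain ⟨rfl, hw⟩ := hconst
      rw [List.eq_replicate_of_mem hw, ← List.replicate_succ', ← List.replicate_succ]
    · rw [← hb (i :: w) j, hcyc, hb (w ++ [j]) i]
      · rw [Ne, List.eq_replicate_iff]
        simp only [List.mem_append, List.mem_singleton, true_and]
        intro hmem
        have hji : j = i := hmem j (Or.inr rfl)
        exact hconst ⟨hji.symm, fun x hx => (hmem x (Or.inl hx)).trans hji.symm⟩
      · simpa [List.eq_replicate_iff] using hconst
  rcases isEmpty_or_nonempty α with _ | ⟨⟨i₀⟩⟩
  · exact ⟨fun _ => Classical.arbitrary R, fun i => isEmptyElim i⟩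
  · refine ⟨fun m => b (List.replicate m i₀), fun i w hw => ?_⟩
    rw [hb w i hw]
    exact eq_of_length_eq_of_cons_eq_concat hshift (by simp)

end WordCombinatorics

theorem coef_eq_zero_of_tr_gen_pow_mul_eq_zero {i : Fin n} {w : List (Fin n)} (hw : w ≠ [])
    (hhead : w.head hw ≠ i) (hlast : w.getLast hw ≠ i) {a : Ass K n}
    (h : tr K n (gen K n i ^ w.length * a) = 0) : coef w a = 0 := by
  have hpos : 0 < w.length := List.length_pos_of_ne_nil hw
  have hcoef := congrArg (cyclicCoef (List.replicate w.length i ++ w)) h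
  rw [map_zero, cyclicCoef_tr, Finset.sum_eq_single_of_mem 0 (by simp [hpos])] at hcoef
  · rwa [List.rotate_zero, gen_pow_eq_word, coef_word_mul, if_pos (List.prefix_append _ _),
      List.drop_left] at hcoef
  · intro k hk hk₀
    rw [gen_pow_eq_word, coef_word_mul, if_neg]
    exact fun hpre => hk₀ <|
      eq_zero_of_replicate_isPrefix_rotate hw hhead hlast (by simpa using hk) hpre

variable {u : TDer K n} (hu : u ∈ sder K n)
include hu

theorem coef_muResidue_cons (i j : Fin n) (w : List (Fin n)) :
    coef (j :: w) (muResidue u i) = coef (w ++ [i]) (muResidue u j) := by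
  obtain ⟨a, ha⟩ : ∃ a, tr K n a = divergence u := (commutators K n).mkQ_surjective _
  rw [← cyclicCoef_divergence hu, ← cyclicCoef_divergence hu, ← ha, cyclicCoef_tr, cyclicCoef_tr,
    ← sum_rotate_succ (i :: j :: w) fun l => coef l a]
  simp only [List.rotate_cons_succ, List.length_cons, List.length_append, List.cons_append,
    List.length_nil]

variable (htr : ∀ a, tr K n (muDefect u a) = 0)
include htr

theorem tr_gen_pow_mul_sub_muResidue (i j : Fin n) (N M : ℕ) :
    tr K n (gen K n i ^ N * ((muResidue u i - muResidue u j) * gen K n j ^ M -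
      gen K n j ^ M * (muResidue u i - muResidue u j))) = 0 := by
  have hd := isDerivation_muDefect hu
  have hcyc := tr_mul_comm K n (muResidue u i) (gen K n i ^ N * gen K n j ^ M)
  rw [← htr (gen K n i ^ N * gen K n j ^ M), hd,
    hd.map_pow_of_map_eq_commutator (muDefect_gen hu i),
    hd.map_pow_of_map_eq_commutator (muDefect_gen hu j)]
  simp only [mul_sub, sub_mul, map_sub, map_add, mul_assoc] at hcyc ⊢
  rw [hcyc]
  abel

theorem coef_muResidue_eq_of_head_ne {i j : Fin n} (hij : i ≠ j) {w : List (Fin n)} (hw : w ≠ [])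
    (hhead : w.head hw ≠ i) (hj : w ≠ List.replicate w.length j) :
    coef w (muResidue u i) = coef w (muResidue u j) := by
  have hpos : w.length ≠ 0 := by simpa using hw
  have hprefix : ¬List.replicate w.length j <+: w ++ List.replicate w.length j := fun h =>
    hj ((List.prefix_of_prefix_length_le (List.prefix_append w _) h (by simp)).eq_of_length
      (by simp))
  have hne : w ++ List.replicate w.length j ≠ [] := by simp [hw]
  have hcoef := coef_eq_zero_of_tr_gen_pow_mul_eq_zero hne
    (by rwa [List.head_append_of_ne_nil hw]) (by simpa [hpos] using hij.symm)
    (tr_gen_pow_mul_sub_muResidue hu htr i j _ w.length)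
  rw [map_sub, gen_pow_eq_word, coef_word_mul, if_neg hprefix, coef_mul_word,
    if_pos (List.suffix_append _ _)] at hcoef
  simpa [sub_eq_zero] using hcoef

theorem coef_muResidue_eq {i j : Fin n} {w : List (Fin n)}
    (hi : w ≠ List.replicate w.length i) (hj : w ≠ List.replicate w.length j) :
    coef w (muResidue u i) = coef w (muResidue u j) := by
  rcases eq_or_ne i j with rfl | hij
  · rfl
  have hw : w ≠ [] := by rintro rfl; exact hi rfl
  by_cases hhead : w.head hw = i
  · exact (coef_muResidue_eq_of_head_ne hu htr hij.symm hw (hhead.trans_ne hij) hi).symm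
  · exact coef_muResidue_eq_of_head_ne hu htr hij hw hhead hj

theorem exists_coef_muResidue_eq : ∃ β : ℕ → K, ∀ (i : Fin n) (w : List (Fin n)),
    w ≠ List.replicate w.length i → coef w (muResidue u i) = β w.length :=
  exists_eq_length_function (f := fun i w => coef w (muResidue u i))
    (fun _ _ _ => coef_muResidue_eq hu htr) (coef_muResidue_cons hu)

end Necessity

section Commutation

variable [CharZero K] (u : TDer K n)

theorem mem_krv_iff_commutes :
    u ∈ krv K n ↔ u ∈ sder K n ∧
      tensorAct (rhoTr u) ∘ₗ deltaGr K n = deltaGr K n ∘ₗ rhoTr u := by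
  constructor
  · intro h
    obtain ⟨β, hβ⟩ := coef_muResidue_of_mem_krv h
    obtain ⟨b, hb⟩ := exists_muDefect_eq_inner h.1 hβ
    exact ⟨h.1, tensorAct_deltaGr_of_muDefect_eq_inner hb⟩
  · rintro ⟨hu, h⟩
    obtain ⟨β, hβ⟩ := exists_coef_muResidue_eq hu (tr_muDefect_eq_zero hu h)
    exact mem_krv_of_coef_muResidue hu hβ

theorem mem_krv₀_iff_commutes :
    u ∈ krv₀ K n ↔ u ∈ sder K n ∧ rho u ∘ₗ muGr K n = muGr K n ∘ₗ rho u := by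
  rw [mem_krv₀_iff_coef_muResidue]
  refine and_congr_right fun hu => ?_
  rw [← muDefect_eq_zero_iff_coef_muResidue hu, muDefect_eq_zero_iff]

end Commutation

end KV

end

theorem theorem5p4 {K : Type*} [Field K] [CharZero K] (n : ℕ) (u : KV.TDer K n) :
    (u ∈ KV.krv K n ↔
      (KV.rho u ∘ₗ KV.etaGr K n = KV.etaGr K n ∘ₗ KV.tensorAct (KV.rho u) ∧
        KV.tensorAct (KV.rhoTr u) ∘ₗ KV.deltaGr K n = KV.deltaGr K n ∘ₗ KV.rhoTr u)) ∧
    (u ∈ KV.krv₀ K n ↔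
      (KV.rho u ∘ₗ KV.etaGr K n = KV.etaGr K n ∘ₗ KV.tensorAct (KV.rho u) ∧
        KV.rho u ∘ₗ KV.muGr K n = KV.muGr K n ∘ₗ KV.rho u)) := by
  rw [← KV.etaDefect_eq_zero_iff, ← KV.mem_sder_iff]
  exact ⟨KV.mem_krv_iff_commutes u, KV.mem_krv₀_iff_commutes u⟩
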